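/- Let $n\ge 0$, let $V=\mathbb{C}^n$ with its standard symmetric bilinear form and standard basis $y_1,\dots,y_n$, and let $x_1,\dots,x_n\in V^*$ be the dual basis. Let $\mathcal{W}$ be the Weyl algebra generated by $y_i,x_j$ with $[y_i,x_j]=\delta_{ij}$, $[y_i,y_j]=[x_i,x_j]=0$, let $\mathcal{C}$ be the Clifford algebra generated by $e_1,\dots,e_n$ with $e_ie_j+e_je_i=2\delta_{ij}$, and let $\mathcal{WC}=\mathcal{W}\otimes\mathcal{C}$, with the $\mathbb{Z}_2$-grading induced from $\mathcal{C}$. Let $\mathfrak{O}\subset\mathcal{WC}$ (the total angular momentum algebra) be the centraliser, with respect to the graded commutator, of the Lie superalgebra $\mathfrak{spo}(2|1)$ generated by the odd elements $\sum_j y_j\otimes e_j$ and $\sum_j x_j\otimes e_j$. Let $\mathfrak{so}(n,\mathbb{C})$ be the Lie algebra of skew-symmetric $n\times n$ matrices, and let $\phi:\mathcal{U}(\mathfrak{so}(n,\mathbb{C}))\to\mathfrak{O}$ be the natural algebra homomorphism, determined by $$E_{ij}-E_{ji}\longmapsto O_{ij}=x_iy_j-x_jy_i+\tfrac12 e_ie_j\qquad(1\le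 i<j\le n).$$ Let $\mathcal{U}^{(p)}$ denote the span in $\mathcal{U}(\mathfrak{so}(n,\mathbb{C}))$ of all products of at most $p$ elements of $\mathfrak{so}(n,\mathbb{C})$. Then $\ker\phi$ has no nonzero elements of filtration degree at most $3$: for every $p\le 3$, $\ker\phi\cap\mathcal{U}^{(p)}=0$. -/

import Mathlib

open scoped TensorProduct

noncomputable section

namespace TAMA

attribute [local instance] LieRing.ofAssociativeRing

/-! ### The Weyl algebra -/

/-- The relations `v ⊗ v' = v' ⊗ v + ω(v, v')` defining the Weyl algebra of `(M, ω)`. -/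
inductive WeylRel {R M : Type*} [CommRing R] [AddCommGroup M] [Module R M]
    (ω : LinearMap.BilinForm R M) : TensorAlgebra R M → TensorAlgebra R M → Prop
  | comm (v w : M) : WeylRel ω
      (TensorAlgebra.ι R v * TensorAlgebra.ι R w)
      (TensorAlgebra.ι R w * TensorAlgebra.ι R v + algebraMap R (TensorAlgebra R M) (ω v w))

/-- The Weyl algebra of `(M, ω)`: the quotient of the tensor algebra of `M` by the two-sided ideal
generated by the elements `v ⊗ v' - v' ⊗ v - ω(v, v')`. -/
def WeylAlgebra {R M : Type*} [CommRing R] [AddCommGroup M] [Module R M]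
    (ω : LinearMap.BilinForm R M) : Type _ := (ringConGen (WeylRel ω)).Quotient

instance {R M : Type*} [CommRing R] [AddCommGroup M] [Module R M] (ω : LinearMap.BilinForm R M) :
    Ring (WeylAlgebra ω) := inferInstanceAs (Ring (RingCon.Quotient _))

instance {R M : Type*} [CommRing R] [AddCommGroup M] [Module R M] (ω : LinearMap.BilinForm R M) :
    Algebra R (WeylAlgebra ω) := inferInstanceAs (Algebra R (RingCon.Quotient _))

/-- The quotient map from the tensor algebra to the Weyl algebra. -/
def weylMk {R M : Type*} [CommRing R] [AddCommGroup M] [Module R M]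
    (ω : LinearMap.BilinForm R M) : TensorAlgebra R M →ₐ[R] WeylAlgebra ω :=
  RingCon.mkₐ R _

/-- The canonical linear map `M → W(M, ω)`. -/
def weylι {R M : Type*} [CommRing R] [AddCommGroup M] [Module R M]
    (ω : LinearMap.BilinForm R M) : M →ₗ[R] WeylAlgebra ω :=
  (weylMk ω).toLinearMap ∘ₗ TensorAlgebra.ι R

/-- The space `V = ℂⁿ`. -/
abbrev V (n : ℕ) : Type := Fin n → ℂ

/-- The space `V ⊕ V*`. -/
abbrev VV (n : ℕ) : Type := V n × Module.Dual ℂ (V n)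

/-- The symplectic form on `V ⊕ V*`: `ω((y, x), (y', x')) = ⟨y, x'⟩ - ⟨y', x⟩`. -/
def omega (n : ℕ) : LinearMap.BilinForm ℂ (VV n) :=
  LinearMap.mk₂ ℂ (fun a b => b.2 a.1 - a.2 b.1)
    (by intro a b c; simp; ring)
    (by intro r a b; simp; ring)
    (by intro a b c; simp; ring)
    (by intro r a b; simp; ring)

/-- The Weyl algebra `W = W(V ⊕ V*, ω)`. -/
abbrev W (n : ℕ) : Type := WeylAlgebra (omega n)

/-- The generators `y_i` of the Weyl algebra (the standard basis of `V`). -/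
def y {n : ℕ} (i : Fin n) : W n := weylι (omega n) (Pi.single i 1, 0)

/-- The generators `x_i` of the Weyl algebra (the dual basis of `V*`). -/
def x {n : ℕ} (i : Fin n) : W n := weylι (omega n) (0, LinearMap.proj i)

/-! ### The Clifford algebra -/

/-- The standard quadratic form `v ↦ ∑ v_i²` on `V = ℂⁿ`. -/
def quadForm (n : ℕ) : QuadraticForm ℂ (V n) :=
  QuadraticMap.weightedSumSquares ℂ (fun _ : Fin n => (1 : ℂ))

/-- The Clifford algebra, with `e_i e_j + e_j e_i = 2 δ_ij`. -/
abbrev C (n : ℕ) : Type := CliffordAlgebra (quadForm n)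

/-- The generators `e_i` of the Clifford algebra. -/
def e {n : ℕ} (i : Fin n) : C n := CliffordAlgebra.ι (quadForm n) (Pi.single i 1)

/-! ### The Weyl-Clifford algebra -/

/-- The Weyl-Clifford algebra `WC = W ⊗ C`. -/
abbrev WC (n : ℕ) : Type := W n ⊗[ℂ] C n

/-- The parity automorphism of `WC`, equal to `1` on the even and to `-1` on the odd part of the
`ℤ/2`-grading induced from `C`. -/
def parity (n : ℕ) : WC n →ₐ[ℂ] WC n :=
  Algebra.TensorProduct.map (AlgHom.id ℂ (W n)) CliffordAlgebra.involute

/-- The Dirac operator `∑ y_j ⊗ e_j`. -/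
def dirac (n : ℕ) : WC n := ∑ j : Fin n, y j ⊗ₜ[ℂ] e j

/-- The element `∑ x_j ⊗ e_j`. -/
def diracX (n : ℕ) : WC n := ∑ j : Fin n, x j ⊗ₜ[ℂ] e j

/-- The odd part of the Lie superalgebra `spo(2|1)` in `WC`. -/
def spoOdd (n : ℕ) : Submodule ℂ (WC n) := Submodule.span ℂ {dirac n, diracX n}

/-- The even part of the Lie superalgebra `spo(2|1)` in `WC`, spanned by the anticommutators of
elements of the odd part. -/
def spoEven (n : ℕ) : Submodule ℂ (WC n) :=
  Submodule.span ℂ {c | ∃ a ∈ spoOdd n, ∃ b ∈ spoOdd n, c = a * b + b * a}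

/-- The total angular momentum algebra: the centraliser of `spo(2|1)` in `WC` with respect to the
graded commutator. An element `a = a₀ + a₁` has vanishing graded commutator with an odd `s` if and
only if `a₀ s = s a₀` and `a₁ s = - s a₁`, that is, `s * a = parity a * s`. -/
def tama (n : ℕ) : Subalgebra ℂ (WC n) where
  carrier := {a | (∀ s ∈ spoEven n, s * a = a * s) ∧ ∀ s ∈ spoOdd n, s * a = parity n a * s}
  mul_mem' := by
    rintro a b ⟨ha, ha'⟩ ⟨hb, hb'⟩
    refine ⟨fun s hs => ?_, fun s hs => ?_⟩
    · rw [← mul_assoc, ha s hs, mul_assoc, hb s hs, mul_assoc]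
    · rw [← mul_assoc, ha' s hs, mul_assoc, hb' s hs, map_mul, mul_assoc]
  add_mem' := by
    rintro a b ⟨ha, ha'⟩ ⟨hb, hb'⟩
    refine ⟨fun s hs => ?_, fun s hs => ?_⟩
    · rw [mul_add, add_mul, ha s hs, hb s hs]
    · rw [mul_add, map_add, add_mul, ha' s hs, hb' s hs]
  algebraMap_mem' := by
    intro r
    refine ⟨fun s _ => (Algebra.commutes r s).symm, fun s _ => ?_⟩
    rw [AlgHom.commutes]
    exact (Algebra.commutes r s).symm

/-! ### The angular momentum operators and the natural homomorphism -/

/-- The Lie algebra `so(n, ℂ)` of skew-symmetric complex `n × n` matrices. -/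
abbrev so (n : ℕ) : LieSubalgebra ℂ (Matrix (Fin n) (Fin n) ℂ) :=
  LieAlgebra.Orthogonal.so (Fin n) ℂ

/-- The angular momentum operators `L_ij = x_i y_j - x_j y_i`. -/
def L {n : ℕ} (i j : Fin n) : W n := x i * y j - x j * y i

/-- The elements `O_ij = L_ij + ½ e_i e_j` of `WC`, the 2-index symmetries for `i ≠ j`. -/
def O {n : ℕ} (i j : Fin n) : WC n :=
  L i j ⊗ₜ[ℂ] (1 : C n) + (1 / 2 : ℂ) • ((1 : W n) ⊗ₜ[ℂ] (e i * e j))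

/-- The basis element `X_ij = E_ij - E_ji` of `so(n, ℂ)`. -/
def X {n : ℕ} (i j : Fin n) : so n :=
  ⟨Matrix.single i j 1 - Matrix.single j i 1, by
    rw [LieAlgebra.Orthogonal.mem_so]; simp [Matrix.transpose_sub]⟩

/-- The linear map `so(n, ℂ) → WC` with `X_ij ↦ O_ij` for `i ≠ j`. -/
def soLin (n : ℕ) : so n →ₗ[ℂ] WC n where
  toFun A := ∑ i : Fin n, ∑ j : Fin n, if i < j then (A : Matrix (Fin n) (Fin n) ℂ) i j • O i j else 0
  map_add' A B := by
    simp only [← Finset.sum_add_distrib]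
    refine Finset.sum_congr rfl fun i _ => Finset.sum_congr rfl fun j _ => ?_
    split_ifs <;> simp [add_smul]
  map_smul' r A := by
    simp only [Finset.smul_sum]
    refine Finset.sum_congr rfl fun i _ => Finset.sum_congr rfl fun j _ => ?_
    split_ifs <;> simp [mul_smul]

/-! #### The map `soLin` is a Lie algebra homomorphism into the total angular momentum algebra -/

theorem weylι_comm {R M : Type*} [CommRing R] [AddCommGroup M] [Module R M]
    (ω : LinearMap.BilinForm R M) (v w : M) :
    weylι ω v * weylι ω w = weylι ω w * weylι ω v + algebraMap R _ (ω v w) := by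
  have h : weylMk ω (TensorAlgebra.ι R v * TensorAlgebra.ι R w) = weylMk ω
      (TensorAlgebra.ι R w * TensorAlgebra.ι R v + algebraMap R (TensorAlgebra R M) (ω v w)) :=
    Quotient.sound (RingCon.le_ringConGen _ _ (WeylRel.comm v w))
  rw [map_mul, map_add, map_mul, AlgHom.commutes] at h
  exact h

theorem omega_apply {n : ℕ} (a b : VV n) : omega n a b = b.2 a.1 - a.2 b.1 := rfl

theorem y_mul_x {n : ℕ} (i j : Fin n) :
    (y i * x j : W n) = x j * y i + if i = j then 1 else 0 := by
  have h : omega n (Pi.single i 1, 0) (0, LinearMap.proj j) = if i = j then 1 else 0 := by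
    simp [omega_apply, Pi.single_apply, eq_comm]
  unfold x y
  rw [weylι_comm, h]
  split_ifs
  · rw [map_one]
  · rw [map_zero]

theorem y_mul_y {n : ℕ} (i j : Fin n) : (y i * y j : W n) = y j * y i := by
  have h : omega n (Pi.single i 1, 0) (Pi.single j 1, 0) = 0 := by simp [omega_apply]
  unfold y
  rw [weylι_comm, h, map_zero, add_zero]

theorem x_mul_x {n : ℕ} (i j : Fin n) : (x i * x j : W n) = x j * x i := by
  have h : omega n (0, LinearMap.proj i) (0, LinearMap.proj j) = 0 := by simp [omega_apply]
  unfold x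
  rw [weylι_comm, h, map_zero, add_zero]

theorem e_mul_e {n : ℕ} (i j : Fin n) :
    (e i * e j : C n) = -(e j * e i) + if i = j then 2 else 0 := by
  have h := CliffordAlgebra.ι_mul_ι_add_swap (Q := quadForm n) (Pi.single i 1) (Pi.single j 1)
  have h2 : QuadraticMap.polar (quadForm n) (Pi.single i 1) (Pi.single j 1)
      = if i = j then 2 else 0 := by
    have h3 : ∀ v w : V n, QuadraticMap.polar (quadForm n) v w = ∑ k, 2 * (v k * w k) := by
      intro v w
      simp only [QuadraticMap.polar, quadForm, QuadraticMap.weightedSumSquares_apply,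
        ← Finset.sum_sub_distrib]
      refine Finset.sum_congr rfl fun k _ => ?_
      simp only [Pi.add_apply, one_smul]
      ring
    rw [h3]
    by_cases hij : i = j
    · simp [Pi.single_apply, hij]
    · simp [Pi.single_apply, hij, Ne.symm hij]
  rw [h2] at h
  unfold e
  rw [eq_sub_of_add_eq h]
  by_cases hij : i = j <;> simp [hij, sub_eq_neg_add, map_ofNat]

/-- The element `∑ A_ij x_i y_j` of the Weyl algebra. -/
def orb {n : ℕ} (A : Matrix (Fin n) (Fin n) ℂ) : W n := ∑ i, ∑ j, A i j • (x i * y j)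

/-- The element `¼ ∑ A_ij e_i e_j` of the Clifford algebra. -/
def spin {n : ℕ} (A : Matrix (Fin n) (Fin n) ℂ) : C n :=
  ∑ i, ∑ j, (1 / 4 : ℂ) • A i j • (e i * e j)

theorem skew_apply {n : ℕ} (A : so n) (i j : Fin n) : A.1 j i = - A.1 i j := by
  have h := (LieAlgebra.Orthogonal.mem_so (Fin n) ℂ A.1).1 A.2
  exact congrFun (congrFun h i) j

theorem soLin_eq {n : ℕ} (A : so n) :
    soLin n A = orb A.1 ⊗ₜ[ℂ] (1 : C n) + (1 : W n) ⊗ₜ[ℂ] spin A.1 := by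
  have hdiag : ∀ i, A.1 i i = 0 := fun i => by
    have := skew_apply A i i
    exact self_eq_neg.mp this
  have hsym : ∀ i j, A.1 j i • O j i = A.1 i j • (O i j : WC n) := by
    intro i j
    by_cases hij : i = j
    · rw [hij]
    · rw [skew_apply A i j]
      have hO : (O j i : WC n) = - O i j := by
        unfold O L
        rw [e_mul_e j i, if_neg (Ne.symm hij), add_zero, TensorProduct.tmul_neg, smul_neg, neg_add,
          ← TensorProduct.neg_tmul, neg_sub]
      rw [hO, neg_smul_neg]
  have h1 : ∑ i, ∑ j, A.1 i j • (O i j : WC n) = (2 : ℂ) • soLin n A := by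
    have h2 : soLin n A = ∑ i, ∑ j, if j < i then A.1 i j • (O i j : WC n) else 0 := by
      change (∑ i : Fin n, ∑ j : Fin n, if i < j then A.1 i j • (O i j : WC n) else 0) = _
      rw [Finset.sum_comm]
      refine Finset.sum_congr rfl fun i _ => Finset.sum_congr rfl fun j _ => ?_
      rw [hsym]
    rw [two_smul]
    nth_rewrite 2 [h2]
    change _ = (∑ i : Fin n, ∑ j : Fin n, if i < j then A.1 i j • (O i j : WC n) else 0) + _
    simp only [← Finset.sum_add_distrib]
    refine Finset.sum_congr rfl fun i _ => Finset.sum_congr rfl fun j _ => ?_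
    rcases lt_trichotomy i j with h | h | h
    · simp [h, h.not_gt]
    · simp [h, hdiag]
    · simp [h, h.not_gt]
  have h3 : ∑ i, ∑ j, A.1 i j • (O i j : WC n)
      = (2 : ℂ) • (orb A.1 ⊗ₜ[ℂ] (1 : C n) + (1 : W n) ⊗ₜ[ℂ] spin A.1) := by
    have h4 : ∑ i, ∑ j, A.1 i j • (L i j : W n) = (2 : ℂ) • orb A.1 := by
      unfold L orb
      simp only [smul_sub, Finset.sum_sub_distrib]
      rw [Finset.sum_comm (f := fun i j => A.1 i j • (x j * y i : W n)), two_smul, sub_eq_add_neg]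
      congr 1
      simp only [← Finset.sum_neg_distrib]
      refine Finset.sum_congr rfl fun i _ => Finset.sum_congr rfl fun j _ => ?_
      rw [skew_apply A i j, neg_smul, neg_neg]
    have h5 : ∑ i, ∑ j, A.1 i j • (1 / 2 : ℂ) • (e i * e j : C n) = (2 : ℂ) • spin A.1 := by
      unfold spin
      simp only [Finset.smul_sum]
      refine Finset.sum_congr rfl fun i _ => Finset.sum_congr rfl fun j _ => ?_
      simp only [smul_smul]
      congr 1
      ring
    rw [smul_add, TensorProduct.smul_tmul', ← TensorProduct.tmul_smul, ← h4, ← h5]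
    simp only [TensorProduct.sum_tmul, TensorProduct.tmul_sum, ← Finset.sum_add_distrib]
    refine Finset.sum_congr rfl fun i _ => Finset.sum_congr rfl fun j _ => ?_
    rw [O, smul_add, TensorProduct.smul_tmul', TensorProduct.tmul_smul, TensorProduct.tmul_smul]
  have := h1.symm.trans h3
  exact smul_right_injective _ (two_ne_zero (α := ℂ)) this

theorem orb_lie_x {n : ℕ} (A : Matrix (Fin n) (Fin n) ℂ) (k : Fin n) :
    orb A * x k = x k * orb A + ∑ i, A i k • (x i : W n) := by
  have h : ∀ i j, A i j • (x i * y j : W n) * x k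
      = x k * (A i j • (x i * y j)) + if j = k then A i j • (x i : W n) else 0 := by
    intro i j
    rw [smul_mul_assoc, mul_assoc, y_mul_x, mul_add, ← mul_assoc, x_mul_x i k, mul_assoc, smul_add,
      mul_smul_comm]
    congr 1
    split_ifs <;> simp
  simp only [orb, Finset.sum_mul, Finset.mul_sum, h, Finset.sum_add_distrib]
  simp

theorem orb_lie_y {n : ℕ} (A : Matrix (Fin n) (Fin n) ℂ) (k : Fin n) :
    orb A * y k = y k * orb A - ∑ j, A k j • (y j : W n) := by
  have h : ∀ i j, A i j • (x i * y j : W n) * y k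
      = y k * (A i j • (x i * y j)) - if k = i then A i j • (y j : W n) else 0 := by
    intro i j
    rw [mul_smul_comm, ← mul_assoc, y_mul_x, add_mul, smul_mul_assoc, mul_assoc, y_mul_y j k,
      mul_assoc, smul_add]
    split_ifs <;> simp
  simp only [orb, Finset.sum_mul, Finset.mul_sum, h, Finset.sum_sub_distrib]
  congr 1
  rw [Finset.sum_comm]
  simp

theorem spin_lie_e {n : ℕ} (A : so n) (k : Fin n) :
    spin A.1 * e k = e k * spin A.1 + ∑ i, A.1 i k • (e i : C n) := by
  have h : ∀ i j, (1 / 4 : ℂ) • A.1 i j • (e i * e j : C n) * e k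
      = e k * ((1 / 4 : ℂ) • A.1 i j • (e i * e j))
        + ((if j = k then (1 / 2 : ℂ) • A.1 i j • (e i : C n) else 0)
          + if i = k then (1 / 2 : ℂ) • A.1 j i • (e j : C n) else 0) := by
    intro i j
    have h1 : (e i * e j * e k : C n) = e k * (e i * e j)
        + ((if j = k then (2 : ℂ) • e i else 0) - if i = k then (2 : ℂ) • e j else 0) := by
      rw [mul_assoc, e_mul_e j k, mul_add, mul_neg, ← mul_assoc, e_mul_e i k, add_mul, neg_mul,
        mul_assoc]
      split_ifs <;> simp [two_smul, two_mul, mul_two] <;> abel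
    rw [smul_mul_assoc, smul_mul_assoc, h1, mul_smul_comm, mul_smul_comm, smul_add, smul_add,
      skew_apply A i j]
    congr 1
    split_ifs <;> simp [smul_smul] <;> module
  simp only [spin, Finset.sum_mul, Finset.mul_sum, h, Finset.sum_add_distrib]
  congr 1
  rw [Finset.sum_comm (f := fun i j => if i = k then (1 / 2 : ℂ) • A.1 j i • (e j : C n) else 0)]
  simp only [← Finset.sum_add_distrib]
  refine Finset.sum_congr rfl fun i _ => ?_
  simp only [Finset.sum_add_distrib, Finset.sum_ite_eq', Finset.mem_univ, if_true]
  module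

theorem orb_lie {n : ℕ} (A B : Matrix (Fin n) (Fin n) ℂ) :
    orb (A * B - B * A) = orb A * orb B - orb B * orb A := by
  have h : ∀ k l, orb A * (B k l • (x k * y l : W n)) = B k l • (x k * y l) * orb A
      + (∑ i, (A i k * B k l) • (x i * y l : W n) - ∑ j, (B k l * A l j) • (x k * y j : W n)) := by
    intro k l
    rw [mul_smul_comm, ← mul_assoc, orb_lie_x, add_mul, mul_assoc, orb_lie_y, mul_sub, smul_mul_assoc,
      smul_add, smul_sub, mul_assoc, Finset.sum_mul, Finset.mul_sum, Finset.smul_sum, Finset.smul_sum]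
    simp only [smul_mul_assoc, mul_smul_comm, smul_smul, mul_comm (B k l)]
    abel
  have h2 : orb A * orb B = orb B * orb A + (orb (A * B) - orb (B * A)) := by
    rw [orb.eq_def B]
    simp only [Finset.mul_sum, h, Finset.sum_mul, Finset.sum_add_distrib, Finset.sum_sub_distrib]
    congr 2
    · simp only [orb, Matrix.mul_apply, Finset.sum_smul]
      rw [Finset.sum_comm' (t' := Finset.univ) (s' := fun _ => Finset.univ) (by simp)]
      rw [Finset.sum_congr rfl fun i _ => Finset.sum_comm]
      rw [Finset.sum_comm]
    · simp only [orb, Matrix.mul_apply, Finset.sum_smul]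
      exact Finset.sum_congr rfl fun i _ => Finset.sum_comm
  have h3 : orb (A * B - B * A) = orb (A * B) - orb (B * A) := by
    simp [orb, sub_smul, Finset.sum_sub_distrib]
  rw [h3, h2]
  abel

theorem spin_lie {n : ℕ} (A B : so n) :
    spin (A.1 * B.1 - B.1 * A.1) = spin A.1 * spin B.1 - spin B.1 * spin A.1 := by
  have h : ∀ k l, spin A.1 * ((1 / 4 : ℂ) • B.1 k l • (e k * e l : C n))
      = (1 / 4 : ℂ) • B.1 k l • (e k * e l) * spin A.1
      + (∑ i, (1 / 4 : ℂ) • (A.1 i k * B.1 k l) • (e i * e l : C n)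
        - ∑ j, (1 / 4 : ℂ) • (B.1 k l * A.1 l j) • (e k * e j : C n)) := by
    intro k l
    have hs : ∑ j, (1 / 4 : ℂ) • (B.1 k l * A.1 l j) • (e k * e j : C n)
        = - ∑ j, (1 / 4 : ℂ) • (B.1 k l * A.1 j l) • (e k * e j : C n) := by
      rw [← Finset.sum_neg_distrib]
      refine Finset.sum_congr rfl fun j _ => ?_
      rw [skew_apply A j l]
      simp
    rw [hs, mul_smul_comm, mul_smul_comm, ← mul_assoc, spin_lie_e, add_mul, mul_assoc, spin_lie_e,
      mul_add, smul_mul_assoc, smul_mul_assoc, smul_add, smul_add, smul_add, smul_add, mul_assoc,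
      Finset.sum_mul, Finset.mul_sum, Finset.smul_sum, Finset.smul_sum, Finset.smul_sum,
      Finset.smul_sum]
    simp only [smul_mul_assoc, mul_smul_comm, smul_smul, mul_comm (B.1 k l)]
    abel
  have h2 : spin A.1 * spin B.1 = spin B.1 * spin A.1 + (spin (A.1 * B.1) - spin (B.1 * A.1)) := by
    rw [spin.eq_def B.1]
    simp only [Finset.mul_sum, h, Finset.sum_mul, Finset.sum_add_distrib, Finset.sum_sub_distrib]
    congr 2
    · simp only [spin, Matrix.mul_apply, Finset.sum_smul, Finset.smul_sum]
      rw [Finset.sum_comm' (t' := Finset.univ) (s' := fun _ => Finset.univ) (by simp)]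
      rw [Finset.sum_congr rfl fun i _ => Finset.sum_comm]
      rw [Finset.sum_comm]
    · simp only [spin, Matrix.mul_apply, Finset.sum_smul, Finset.smul_sum]
      exact Finset.sum_congr rfl fun i _ => Finset.sum_comm
  have h3 : spin (A.1 * B.1 - B.1 * A.1) = spin (A.1 * B.1) - spin (B.1 * A.1) := by
    simp [spin, sub_smul, smul_sub, Finset.sum_sub_distrib]
  rw [h3, h2]
  abel

theorem soLin_lie {n : ℕ} (A B : so n) :
    soLin n ⁅A, B⁆ = soLin n A * soLin n B - soLin n B * soLin n A := by
  have hAB : (⁅A, B⁆ : so n).1 = A.1 * B.1 - B.1 * A.1 := rfl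
  simp only [soLin_eq, hAB, orb_lie, spin_lie, mul_add, add_mul,
    Algebra.TensorProduct.tmul_mul_tmul, one_mul, mul_one, TensorProduct.sub_tmul,
    TensorProduct.tmul_sub]
  abel

theorem parity_soLin {n : ℕ} (A : so n) : parity n (soLin n A) = soLin n A := by
  rw [soLin_eq]
  simp [parity, spin, e, map_sum]

theorem dirac_mul_soLin {n : ℕ} (A : so n) : dirac n * soLin n A = soLin n A * dirac n := by
  have h : ∀ k, soLin n A * (y k ⊗ₜ[ℂ] e k) = (y k ⊗ₜ[ℂ] e k) * soLin n A
      + (∑ i, A.1 i k • ((y k : W n) ⊗ₜ[ℂ] (e i : C n))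
        - ∑ j, A.1 k j • ((y j : W n) ⊗ₜ[ℂ] (e k : C n))) := by
    intro k
    simp only [soLin_eq, mul_add, add_mul, Algebra.TensorProduct.tmul_mul_tmul, one_mul, mul_one,
      orb_lie_y, spin_lie_e, TensorProduct.sub_tmul, TensorProduct.tmul_add,
      TensorProduct.sum_tmul, TensorProduct.tmul_sum, TensorProduct.smul_tmul',
      TensorProduct.tmul_smul]
    abel
  rw [dirac, Finset.sum_mul, Finset.mul_sum]
  simp only [h, Finset.sum_add_distrib, Finset.sum_sub_distrib]
  rw [Finset.sum_comm, sub_self, add_zero]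

theorem diracX_mul_soLin {n : ℕ} (A : so n) : diracX n * soLin n A = soLin n A * diracX n := by
  have h : ∀ k, soLin n A * (x k ⊗ₜ[ℂ] e k) = (x k ⊗ₜ[ℂ] e k) * soLin n A
      + (∑ i, A.1 i k • ((x k : W n) ⊗ₜ[ℂ] (e i : C n))
        - ∑ j, A.1 k j • ((x j : W n) ⊗ₜ[ℂ] (e k : C n))) := by
    intro k
    have hs : ∑ j, A.1 k j • ((x j : W n) ⊗ₜ[ℂ] (e k : C n))
        = - ∑ j, A.1 j k • ((x j : W n) ⊗ₜ[ℂ] (e k : C n)) := by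
      rw [← Finset.sum_neg_distrib]
      refine Finset.sum_congr rfl fun j _ => ?_
      rw [skew_apply A j k, neg_smul]
    rw [hs]
    simp only [soLin_eq, mul_add, add_mul, Algebra.TensorProduct.tmul_mul_tmul, one_mul, mul_one,
      orb_lie_x, spin_lie_e, TensorProduct.add_tmul, TensorProduct.tmul_add,
      TensorProduct.sum_tmul, TensorProduct.tmul_sum, TensorProduct.smul_tmul',
      TensorProduct.tmul_smul]
    abel
  rw [diracX, Finset.sum_mul, Finset.mul_sum]
  simp only [h, Finset.sum_add_distrib, Finset.sum_sub_distrib]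
  rw [Finset.sum_comm, sub_self, add_zero]

theorem soLin_mem_tama {n : ℕ} (A : so n) : soLin n A ∈ tama n := by
  have hodd : ∀ s ∈ spoOdd n, s * soLin n A = soLin n A * s := by
    intro s hs
    obtain ⟨a, b, rfl⟩ := Submodule.mem_span_pair.1 hs
    simp only [add_mul, mul_add, smul_mul_assoc, mul_smul_comm, dirac_mul_soLin, diracX_mul_soLin]
  refine ⟨fun s hs => ?_, fun s hs => by rw [parity_soLin]; exact hodd s hs⟩
  induction hs using Submodule.span_induction with
  | mem s hs =>
    obtain ⟨a, ha, b, hb, rfl⟩ := hs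
    rw [add_mul, mul_add, mul_assoc, hodd b hb, ← mul_assoc, hodd a ha, mul_assoc b, hodd a ha,
      ← mul_assoc b, hodd b hb, mul_assoc, mul_assoc]
  | zero => simp
  | add s t _ _ hs ht => rw [add_mul, mul_add, hs, ht]
  | smul r s _ hs => rw [smul_mul_assoc, mul_smul_comm, hs]

/-- The Lie algebra homomorphism `so(n, ℂ) → 𝔒` with `X_ij ↦ O_ij` for `i ≠ j`. -/
def soHom (n : ℕ) : so n →ₗ⁅ℂ⁆ tama n where
  toLinearMap := (soLin n).codRestrict (Subalgebra.toSubmodule (tama n)) soLin_mem_tama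
  map_lie' {A B} := Subtype.ext (soLin_lie A B)

/-- The natural homomorphism `U(so(n, ℂ)) → 𝔒`. -/
def natHom (n : ℕ) : UniversalEnvelopingAlgebra ℂ (so n) →ₐ[ℂ] tama n :=
  UniversalEnvelopingAlgebra.lift ℂ (soHom n)

theorem natHom_X {n : ℕ} {i j : Fin n} (hij : i ≠ j) :
    (natHom n (UniversalEnvelopingAlgebra.ι ℂ (X i j)) : WC n) = O i j := by
  rw [natHom, UniversalEnvelopingAlgebra.lift_ι_apply]
  change soLin n (X i j) = O i j
  rw [soLin_eq]
  have h1 : orb (X i j).1 = (L i j : W n) := by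
    simp [orb, X, L, Matrix.single_apply, sub_smul, Finset.sum_sub_distrib, ite_and]
  have h2 : spin (X i j).1 = (1 / 2 : ℂ) • (e i * e j : C n) := by
    have : spin (X i j).1 = (1 / 4 : ℂ) • (e i * e j - e j * e i : C n) := by
      simp [spin, X, Matrix.single_apply, sub_smul, smul_sub, Finset.sum_sub_distrib, ite_and]
    rw [this, e_mul_e j i, if_neg (Ne.symm hij)]
    module
  rw [h1, h2, TensorProduct.tmul_smul, O]

/-- The standard filtration of a universal enveloping algebra: the span of all products of at most
`p` elements of the Lie algebra. -/
def ueaFiltration (R 𝔤 : Type*) [CommRing R] [LieRing 𝔤] [LieAlgebra R 𝔤] (p : ℕ) :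
    Submodule R (UniversalEnvelopingAlgebra R 𝔤) :=
  Submodule.span R {u | ∃ l : List 𝔤, l.length ≤ p ∧
    u = (l.map (UniversalEnvelopingAlgebra.ι R)).prod}

end TAMA

end

open scoped TensorProduct

noncomputable section

namespace TAMA

attribute [local instance] LieRing.ofAssociativeRing

/-! ### Linear forms on the Weyl algebra -/

/-! The argument is a leading-symbol computation: for p = 3, 2, 1, a kernel element of `U^(p)` is
shown to lie in `U^(p-1)`, and the scalars left at the end inject because 1 maps to a nonzero
element. Only the spanning half of PBW is used: modulo `U^(p-1)`, an element of `U^(p)` is a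
combination of words of length p, and it lies in `U^(p-1)` as soon as its symmetrised coefficient
tensor vanishes.

To detect that tensor, `natHom` is paired with products α ⊗ β. Here α takes the part of x-degree k
of the normally ordered Weyl symbol and evaluates it at a point (ξ, μ), while β is an alternating
form evaluated on one degree of the Clifford algebra, identified with the exterior algebra. Under
`natHom` a Lie algebra element A becomes `orb A` plus `spin A`. The first has symbol ξᵀAμ and the
second has degree 2. Choosing k orbital and p - k spin factors therefore isolates a contraction of
the leading tensor with the decomposable forms `minor v w`, which are the elements v ∧ w of so(n)* ≅
Λ²V, and shorter words contribute nothing.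

In degree 3 the tensor gives a symmetric trilinear form T on so(n)*. Two orbital factors and one
spin factor show T(v∧w, v∧w, p∧q) = 0. Both orbital factors see the same point, so with p∧q fixed
only the part of Sym²(Λ²V) detected by squares of decomposables is killed, and a Λ⁴ part may
survive. One orbital and two spin factors give the missing piece: the total alternation of T(p∧q, ·,
·) over four vectors vanishes. By `bilin_dual_so_eq_zero` the two conditions force T(p∧q, ·, ·) = 0,
and T = 0 since decomposables span. In degrees 2 and 1, one orbital and one spin factor,
respectively one spin factor, are enough. -/

/-- The universal property of the Weyl algebra. -/
def weylLift {R M A : Type*} [CommRing R] [AddCommGroup M] [Module R M] [Ring A] [Algebra R A]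
    (ω : LinearMap.BilinForm R M) (f : M →ₗ[R] A)
    (hf : ∀ v w, f v * f w = f w * f v + algebraMap R A (ω v w)) : WeylAlgebra ω →ₐ[R] A :=
  RingCon.liftₐ (ringConGen (WeylRel ω)) (TensorAlgebra.lift R f) (by
    refine RingCon.ringConGen_le.2 ?_
    rintro _ _ ⟨v, w⟩
    change TensorAlgebra.lift R f _ = TensorAlgebra.lift R f _
    simp only [map_mul, map_add, TensorAlgebra.lift_ι_apply, AlgHom.commutes]
    exact hf v w)

theorem weylLift_weylι {R M A : Type*} [CommRing R] [AddCommGroup M] [Module R M] [Ring A]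
    [Algebra R A] (ω : LinearMap.BilinForm R M) (f : M →ₗ[R] A)
    (hf : ∀ v w, f v * f w = f w * f v + algebraMap R A (ω v w)) (v : M) :
    weylLift ω f hf (weylι ω v) = f v :=
  TensorAlgebra.lift_ι_apply f v

/-- The derivation of the polynomial ring in the direction of `v`. -/
def dirDeriv {n : ℕ} :
    V n →ₗ[ℂ] Derivation ℂ (MvPolynomial (Fin n) ℂ) (MvPolynomial (Fin n) ℂ) where
  toFun v := MvPolynomial.mkDerivation ℂ fun i => MvPolynomial.C (v i)
  map_add' v w := MvPolynomial.derivation_ext fun i => by simp [MvPolynomial.mkDerivation_X]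
  map_smul' r v := MvPolynomial.derivation_ext fun i => by
    simp [MvPolynomial.mkDerivation_X, MvPolynomial.smul_eq_C_mul]

theorem dirDeriv_X {n : ℕ} (v : V n) (i : Fin n) :
    dirDeriv v (MvPolynomial.X i) = MvPolynomial.C (v i) :=
  MvPolynomial.mkDerivation_X _ _ _

/-- The commutator of two derivations is a derivation, and this one kills the variables because each
directional derivative sends them to constants. -/
theorem dirDeriv_comm {n : ℕ} (v w : V n) (p : MvPolynomial (Fin n) ℂ) :
    dirDeriv v (dirDeriv w p) = dirDeriv w (dirDeriv v p) := by
  have h : ⁅dirDeriv v, dirDeriv w⁆ = 0 := MvPolynomial.derivation_ext fun i => by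
    simp [Derivation.commutator_apply, dirDeriv_X]
  have := DFunLike.congr_fun h p
  rw [Derivation.commutator_apply] at this
  exact sub_eq_zero.1 this

/-- The linear polynomial of a linear form. -/
def linPoly {n : ℕ} : Module.Dual ℂ (V n) →ₗ[ℂ] MvPolynomial (Fin n) ℂ where
  toFun f := ∑ i, f (Pi.single i 1) • MvPolynomial.X i
  map_add' f g := by simp [add_smul, Finset.sum_add_distrib]
  map_smul' r f := by simp [Finset.smul_sum, mul_smul]

theorem dirDeriv_linPoly {n : ℕ} (v : V n) (f : Module.Dual ℂ (V n)) :
    dirDeriv v (linPoly f) = MvPolynomial.C (f v) := by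
  conv_rhs => rw [pi_eq_sum_univ' v]
  simp [linPoly, dirDeriv_X, MvPolynomial.smul_eq_C_mul, mul_comm]

/-- The generators of the Weyl algebra acting on polynomials, with `y_i` acting by `∂_i + μ_i`. -/
def weylOp {n : ℕ} (μ : V n) : VV n →ₗ[ℂ] Module.End ℂ (MvPolynomial (Fin n) ℂ) where
  -- The scalar shift is conjugation of the usual action by exp(μ·x). Applying an operator to 1 then
  -- gives its normally ordered symbol with each y_i replaced by μ_i.
  toFun a := LinearMap.mulLeft ℂ (linPoly a.2) + (dirDeriv a.1 : _ →ₗ[ℂ] _)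
    + (μ ⬝ᵥ a.1) • LinearMap.id
  map_add' a b := by
    refine LinearMap.ext fun p => ?_
    simp only [Prod.fst_add, Prod.snd_add, map_add, dotProduct_add, LinearMap.add_apply,
      LinearMap.mulLeft_apply, LinearMap.smul_apply, LinearMap.id_apply, add_mul, add_smul,
      Derivation.coeFn_coe, Derivation.add_apply]
    abel
  map_smul' r a := by
    refine LinearMap.ext fun p => ?_
    simp [mul_smul]

theorem weylOp_apply {n : ℕ} (μ : V n) (a : VV n) (p : MvPolynomial (Fin n) ℂ) :
    weylOp μ a p = linPoly a.2 * p + dirDeriv a.1 p + (μ ⬝ᵥ a.1) • p := rfl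

theorem weylOp_comm {n : ℕ} (μ : V n) (a b : VV n) :
    weylOp μ a * weylOp μ b = weylOp μ b * weylOp μ a + algebraMap ℂ _ (omega n a b) := by
  refine LinearMap.ext fun p => ?_
  simp only [Module.End.mul_apply, LinearMap.add_apply, weylOp_apply, map_add, Derivation.leibniz,
    dirDeriv_linPoly, Module.algebraMap_end_apply, omega_apply, Derivation.map_smul, smul_eq_mul,
    dirDeriv_comm b.1 a.1]
  simp only [MvPolynomial.smul_eq_C_mul, map_sub]
  ring

/-- The representation of the Weyl algebra on polynomials with `y_i` acting by `∂_i + μ_i`. -/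
def weylRep {n : ℕ} (μ : V n) : W n →ₐ[ℂ] Module.End ℂ (MvPolynomial (Fin n) ℂ) :=
  weylLift (omega n) (weylOp μ) (weylOp_comm μ)

theorem weylRep_x {n : ℕ} (μ : V n) (i : Fin n) (p : MvPolynomial (Fin n) ℂ) :
    weylRep μ (x i) p = MvPolynomial.X i * p := by
  rw [weylRep, x, weylLift_weylι, weylOp_apply]
  simp [linPoly, Pi.single_apply]

theorem weylRep_y {n : ℕ} (μ : V n) (i : Fin n) (p : MvPolynomial (Fin n) ℂ) :
    weylRep μ (y i) p = MvPolynomial.pderiv i p + μ i • p := by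
  have h : dirDeriv (Pi.single i 1 : V n) = MvPolynomial.pderiv i :=
    MvPolynomial.derivation_ext fun j => by
      rw [dirDeriv_X, MvPolynomial.pderiv_X, Pi.single_apply, Pi.single_apply]
      simp [eq_comm, apply_ite MvPolynomial.C]
  rw [weylRep, y, weylLift_weylι, weylOp_apply, h]
  simp

/-- The symbol of `orb A` with the momenta specialised to `μ`. -/
def orbPoly {n : ℕ} (μ : V n) (A : Matrix (Fin n) (Fin n) ℂ) : MvPolynomial (Fin n) ℂ :=
  ∑ i, ∑ j, (A i j * μ j) • MvPolynomial.X i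

theorem isHomogeneous_sum_smul_X {n : ℕ} (c : Fin n → ℂ) :
    (∑ i, c i • MvPolynomial.X i : MvPolynomial (Fin n) ℂ).IsHomogeneous 1 :=
  MvPolynomial.IsHomogeneous.sum _ _ _ fun i _ => by
    rw [MvPolynomial.smul_eq_C_mul]
    exact (MvPolynomial.isHomogeneous_X ℂ i).C_mul _

theorem isHomogeneous_orbPoly {n : ℕ} (μ : V n) (A : Matrix (Fin n) (Fin n) ℂ) :
    (orbPoly μ A).IsHomogeneous 1 := by
  simp only [orbPoly, ← Finset.sum_smul]
  exact isHomogeneous_sum_smul_X _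

/-- The operator splits by degree: multiplication by a linear form, which raises degree by one, plus
a linear vector field, which preserves it. -/
theorem weylRep_orb {n : ℕ} (μ : V n) (A : Matrix (Fin n) (Fin n) ℂ)
    (p : MvPolynomial (Fin n) ℂ) :
    weylRep μ (orb A) p = orbPoly μ A * p
      + ∑ i, ∑ j, A i j • (MvPolynomial.X i * MvPolynomial.pderiv j p) := by
  simp only [orb, orbPoly, map_sum, map_smul, map_mul, LinearMap.sum_apply, LinearMap.smul_apply,
    Module.End.mul_apply, weylRep_x, weylRep_y, Finset.sum_mul, ← Finset.sum_add_distrib]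
  refine Finset.sum_congr rfl fun i _ => Finset.sum_congr rfl fun j _ => ?_
  simp only [MvPolynomial.smul_eq_C_mul, map_mul]
  ring

theorem weylRep_orb_one {n : ℕ} (μ : V n) (A : Matrix (Fin n) (Fin n) ℂ) :
    weylRep μ (orb A) 1 = orbPoly μ A := by
  rw [weylRep_orb]
  simp

/-- The correction q is the linear vector field of A applied to the linear form of B. It stays in
degree 1 and is invisible to the degree 2 component. -/
theorem weylRep_orb_mul_orb_one {n : ℕ} (μ : V n) (A B : Matrix (Fin n) (Fin n) ℂ) :
    ∃ q : MvPolynomial (Fin n) ℂ, q.IsHomogeneous 1 ∧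
      weylRep μ (orb A * orb B) 1 = orbPoly μ A * orbPoly μ B + q := by
  rw [map_mul, Module.End.mul_apply, weylRep_orb_one, weylRep_orb]
  refine ⟨_, ?_, rfl⟩
  have h : ∀ j, MvPolynomial.pderiv j (orbPoly μ B) = MvPolynomial.C (∑ k, B j k * μ k) := by
    intro j
    simp only [orbPoly, map_sum, ← Finset.sum_smul, Derivation.map_smul, MvPolynomial.pderiv_X,
      Pi.single_apply]
    simp [MvPolynomial.smul_eq_C_mul]
  have h2 : ∀ i j, A i j • (MvPolynomial.X i * MvPolynomial.C (∑ k, B j k * μ k))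
      = (A i j * ∑ k, B j k * μ k) • (MvPolynomial.X i : MvPolynomial (Fin n) ℂ) := by
    intro i j
    simp only [MvPolynomial.smul_eq_C_mul, map_mul]
    ring
  simp only [h, h2, ← Finset.sum_smul]
  exact isHomogeneous_sum_smul_X _

/-- The value at `(ξ, μ)` of the part of degree `k` in the `x_i` of the symbol. -/
def weylSymbol {n : ℕ} (k : ℕ) (ξ μ : V n) : W n →ₗ[ℂ] ℂ :=
  (MvPolynomial.aeval ξ).toLinearMap ∘ₗ MvPolynomial.homogeneousComponent k ∘ₗ
    LinearMap.applyₗ 1 ∘ₗ (weylRep μ).toLinearMap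

theorem weylSymbol_apply {n : ℕ} (k : ℕ) (ξ μ : V n) (w : W n) : weylSymbol k ξ μ w
    = MvPolynomial.aeval ξ (MvPolynomial.homogeneousComponent k (weylRep μ w 1)) := rfl

theorem weylSymbol_one {n : ℕ} (k : ℕ) (ξ μ : V n) :
    weylSymbol k ξ μ 1 = if k = 0 then 1 else 0 := by
  rw [weylSymbol_apply, map_one (weylRep μ)]
  change MvPolynomial.aeval ξ (MvPolynomial.homogeneousComponent k 1) = _
  rw [MvPolynomial.homogeneousComponent_of_mem (MvPolynomial.isHomogeneous_one _ _)]
  split_ifs <;> simp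

/-- The linear form `A ↦ vᵀ A w` on `so(n)`. -/
def minor {n : ℕ} : V n →ₗ[ℂ] V n →ₗ[ℂ] Module.Dual ℂ (so n) :=
  LinearMap.mk₂ ℂ (fun v w =>
    { toFun := fun A => ∑ i, ∑ j, A.1 i j * (v i * w j)
      map_add' := fun A B => by simp [add_mul, Finset.sum_add_distrib]
      map_smul' := fun r A => by simp [Finset.mul_sum, mul_assoc] })
    (fun v v' w => by ext A; simp [mul_add, add_mul, Finset.sum_add_distrib])
    (fun r v w => by ext A; simp [Finset.mul_sum, mul_assoc, mul_left_comm])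
    (fun v w w' => by ext A; simp [mul_add, Finset.sum_add_distrib])
    (fun r v w => by ext A; simp [Finset.mul_sum, mul_left_comm])

theorem minor_apply {n : ℕ} (v w : V n) (A : so n) :
    minor v w A = ∑ i, ∑ j, A.1 i j * (v i * w j) := rfl

theorem aeval_orbPoly {n : ℕ} (ξ μ : V n) (A : so n) :
    MvPolynomial.aeval ξ (orbPoly μ A.1) = minor ξ μ A := by
  simp only [orbPoly, minor_apply, map_sum, map_smul, MvPolynomial.aeval_X, smul_eq_mul]
  exact Finset.sum_congr rfl fun i _ => Finset.sum_congr rfl fun j _ => by ring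

theorem weylSymbol_orb {n : ℕ} (k : ℕ) (ξ μ : V n) (A : so n) :
    weylSymbol k ξ μ (orb A.1) = if k = 1 then minor ξ μ A else 0 := by
  rw [weylSymbol_apply, weylRep_orb_one,
    MvPolynomial.homogeneousComponent_of_mem (isHomogeneous_orbPoly μ A.1)]
  split_ifs
  · exact aeval_orbPoly ξ μ A
  · simp

theorem weylSymbol_two_orb_mul_orb {n : ℕ} (ξ μ : V n) (A B : so n) :
    weylSymbol 2 ξ μ (orb A.1 * orb B.1) = minor ξ μ A * minor ξ μ B := by
  obtain ⟨q, hq, h⟩ := weylRep_orb_mul_orb_one μ A.1 B.1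
  rw [weylSymbol_apply, h, map_add, MvPolynomial.homogeneousComponent_of_mem hq,
    MvPolynomial.homogeneousComponent_of_mem
      ((isHomogeneous_orbPoly μ A.1).mul (isHomogeneous_orbPoly μ B.1))]
  rw [if_pos rfl, if_neg (by decide), add_zero, map_mul, aeval_orbPoly, aeval_orbPoly]

/-! ### Linear forms on the Clifford algebra -/

theorem liftAlternating_ι_mul_ι {R M N : Type*} [CommRing R] [AddCommGroup M] [AddCommGroup N]
    [Module R M] [Module R N] (f : ∀ i, M [⋀^Fin i]→ₗ[R] N) (a b : M) :
    ExteriorAlgebra.liftAlternating f (ExteriorAlgebra.ι R a * ExteriorAlgebra.ι R b)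
      = f 2 ![a, b] := by
  rw [← ExteriorAlgebra.liftAlternating_apply_ιMulti f, ExteriorAlgebra.ιMulti_apply]
  simp

theorem liftAlternating_ι_mul_ι_mul_ι_mul_ι {R M N : Type*} [CommRing R] [AddCommGroup M]
    [AddCommGroup N] [Module R M] [Module R N] (f : ∀ i, M [⋀^Fin i]→ₗ[R] N) (a b c d : M) :
    ExteriorAlgebra.liftAlternating f (ExteriorAlgebra.ι R a * (ExteriorAlgebra.ι R b *
      (ExteriorAlgebra.ι R c * ExteriorAlgebra.ι R d))) = f 4 ![a, b, c, d] := by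
  rw [← ExteriorAlgebra.liftAlternating_apply_ιMulti f, ExteriorAlgebra.ιMulti_apply]
  simp

/-- The alternating form of degree `k` evaluated at the part of degree `k` of an element of the
Clifford algebra. -/
def cliffordSymbol {n k : ℕ} (ω : V n [⋀^Fin k]→ₗ[ℂ] ℂ) : C n →ₗ[ℂ] ℂ :=
  ExteriorAlgebra.liftAlternating (Pi.single k ω) ∘ₗ
    (CliffordAlgebra.equivExterior (quadForm n)).toLinearMap

/-- Exposes `changeForm`, whose recursion writes a Clifford product as the exterior product plus
contraction terms of lower degree. -/
theorem cliffordSymbol_apply {n k : ℕ} (ω : V n [⋀^Fin k]→ₗ[ℂ] ℂ) (a : C n) :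
    cliffordSymbol ω a = ExteriorAlgebra.liftAlternating (Pi.single k ω)
      (CliffordAlgebra.changeForm (Q' := 0)
        CliffordAlgebra.changeForm.associated_neg_proof a) := rfl

theorem cliffordSymbol_one {n k : ℕ} (hk : k ≠ 0) (ω : V n [⋀^Fin k]→ₗ[ℂ] ℂ) :
    cliffordSymbol ω 1 = 0 := by
  rw [cliffordSymbol_apply, CliffordAlgebra.changeForm_one, ExteriorAlgebra.liftAlternating_one,
    Pi.single_eq_of_ne hk.symm]
  rfl

/-- The contraction term is a scalar, killed since k ≠ 0. Leaving `Pi.single` in the value treats k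
= 2 and the vanishing cases together. -/
theorem cliffordSymbol_ι_mul_ι {n k : ℕ} (hk : k ≠ 0) (ω : V n [⋀^Fin k]→ₗ[ℂ] ℂ) (a b : V n) :
    cliffordSymbol ω (CliffordAlgebra.ι _ a * CliffordAlgebra.ι _ b)
      = (Pi.single k ω : ∀ i, V n [⋀^Fin i]→ₗ[ℂ] ℂ) 2 ![a, b] := by
  rw [cliffordSymbol_apply, CliffordAlgebra.changeForm_ι_mul_ι, map_sub,
    ExteriorAlgebra.liftAlternating_algebraMap, Pi.single_eq_of_ne hk.symm]
  rw [AlternatingMap.zero_apply, smul_zero, sub_zero]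
  exact liftAlternating_ι_mul_ι _ a b

/-- Every contraction lowers the degree by two, so the corrections have degree 0 or 2 and a 4-form
does not see them. -/
theorem cliffordSymbol_ι_mul_ι_mul_ι_mul_ι {n : ℕ} (ω : V n [⋀^Fin 4]→ₗ[ℂ] ℂ) (a b c d : V n) :
    cliffordSymbol ω (CliffordAlgebra.ι _ a * (CliffordAlgebra.ι _ b *
      (CliffordAlgebra.ι _ c * CliffordAlgebra.ι _ d))) = ω ![a, b, c, d] := by
  have h1 : ExteriorAlgebra.liftAlternating (Pi.single 4 ω) (1 : CliffordAlgebra 0) = 0 := by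
    rw [ExteriorAlgebra.liftAlternating_one, Pi.single_eq_of_ne (by decide)]
    rfl
  have h2 (v w : V n) : ExteriorAlgebra.liftAlternating (Pi.single 4 ω)
      (CliffordAlgebra.ι (0 : QuadraticForm ℂ (V n)) v * CliffordAlgebra.ι 0 w) = 0 := by
    refine (liftAlternating_ι_mul_ι _ v w).trans ?_
    rw [Pi.single_eq_of_ne (by decide)]
    rfl
  rw [cliffordSymbol_apply]
  simp only [CliffordAlgebra.changeForm_ι_mul, CliffordAlgebra.changeForm_ι,
    CliffordAlgebra.contractLeft_ι_mul, CliffordAlgebra.contractLeft_ι, map_sub, mul_sub, map_smul,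
    Algebra.algebraMap_eq_smul_one, CliffordAlgebra.contractLeft_one, mul_smul_comm, mul_one,
    smul_zero, sub_zero, h1, h2]
  refine (liftAlternating_ι_mul_ι_mul_ι_mul_ι _ a b c d).trans ?_
  rw [Pi.single_eq_same]

/-- The wedge product of the linear forms `v ↦ P a ⬝ v`. -/
def wedge {n k : ℕ} (P : Fin k → V n) : V n [⋀^Fin k]→ₗ[ℂ] ℂ :=
  Matrix.detRowAlternating.compLinearMap (LinearMap.pi fun a => dotProductBilin ℂ ℂ (P a))

/-- Leibniz expansion of the transposed determinant, so that the permutations act on the vectors P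
and not on the indices I. -/
theorem wedge_single {n k : ℕ} (P : Fin k → V n) (I : Fin k → Fin n) :
    wedge P (fun a => Pi.single (I a) 1)
      = ∑ σ : Equiv.Perm (Fin k), (Equiv.Perm.sign σ : ℂ) * ∏ a, P (σ a) (I a) := by
  have h : wedge P (fun a => Pi.single (I a) 1) = (Matrix.of fun a b => P a (I b)).det := by
    rw [← Matrix.det_transpose]
    change Matrix.det (fun a b => P b ⬝ᵥ Pi.single (I a) 1) = _
    congr 1
    ext a b
    simp
  rw [h, Matrix.det_apply']
  rfl

theorem cliffordSymbol_wedge_spin {n k : ℕ} (hk : k ≠ 0) (hk2 : k ≠ 2) (P : Fin k → V n)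
    (A : so n) : cliffordSymbol (wedge P) (spin A.1) = 0 := by
  simp only [spin, map_sum, map_smul, e, cliffordSymbol_ι_mul_ι hk, Pi.single_eq_of_ne hk2.symm]
  simp

/-- Skew-symmetry of A makes `minor` factor through Λ²V. -/
theorem minor_swap {n : ℕ} (v w : V n) : minor v w = -minor w v := by
  ext A
  rw [LinearMap.neg_apply, minor_apply, minor_apply, Finset.sum_comm, ← Finset.sum_neg_distrib]
  refine Finset.sum_congr rfl fun i _ => ?_
  rw [← Finset.sum_neg_distrib]
  refine Finset.sum_congr rfl fun j _ => ?_
  rw [skew_apply A i j]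
  ring

/-- The constant is the 1/4 in `spin` times 2, because p ∧ q on e_i, e_j antisymmetrises a sum that
is already skew. -/
theorem cliffordSymbol_wedge_two_spin {n : ℕ} (p q : V n) (A : so n) :
    cliffordSymbol (wedge ![p, q]) (spin A.1) = 1 / 2 * minor p q A := by
  have h (i j : Fin n) : wedge ![p, q] ![Pi.single i 1, Pi.single j 1] = p i * q j - q i * p j := by
    have := wedge_single ![p, q] ![i, j]
    rw [show (fun a => Pi.single (![i, j] a) 1 : Fin 2 → V n) = ![Pi.single i 1, Pi.single j 1] by
      ext a; fin_cases a <;> rfl] at this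
    refine this.trans ((Matrix.det_apply' (Matrix.of fun a b => ![p, q] a (![i, j] b))).symm.trans ?_)
    rw [Matrix.det_fin_two]
    simp
    ring
  have h2 : minor p q A = 1 / 2 * (minor p q A - minor q p A) := by
    rw [minor_swap q p, LinearMap.neg_apply]
    ring
  rw [h2]
  simp only [spin, map_sum, map_smul, e, cliffordSymbol_ι_mul_ι two_ne_zero, Pi.single_eq_same, h,
    minor_apply, smul_eq_mul, Finset.mul_sum, ← Finset.sum_sub_distrib]
  refine Finset.sum_congr rfl fun i _ => Finset.sum_congr rfl fun j _ => ?_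
  ring

theorem cliffordSymbol_wedge_four_spin_mul_spin {n : ℕ} (P : Fin 4 → V n) (A B : so n) :
    cliffordSymbol (wedge P) (spin A.1 * spin B.1) = 1 / 16 *
      ∑ σ : Equiv.Perm (Fin 4), (Equiv.Perm.sign σ : ℂ) *
        (minor (P (σ 0)) (P (σ 1)) A * minor (P (σ 2)) (P (σ 3)) B) := by
  have h (i j k l : Fin n) :
      wedge P ![Pi.single i 1, Pi.single j 1, Pi.single k 1, Pi.single l 1]
        = ∑ σ : Equiv.Perm (Fin 4), (Equiv.Perm.sign σ : ℂ) *
          (P (σ 0) i * P (σ 1) j * P (σ 2) k * P (σ 3) l) := by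
    have := wedge_single P ![i, j, k, l]
    rw [show (fun a => Pi.single (![i, j, k, l] a) 1 : Fin 4 → V n)
        = ![Pi.single i 1, Pi.single j 1, Pi.single k 1, Pi.single l 1] by
      ext a; fin_cases a <;> rfl] at this
    rw [this]
    simp [Fin.prod_univ_four]
  have h2 (i j k l : Fin n) : cliffordSymbol (wedge P) (e i * e j * (e k * e l))
      = wedge P ![Pi.single i 1, Pi.single j 1, Pi.single k 1, Pi.single l 1] := by
    rw [mul_assoc]
    exact cliffordSymbol_ι_mul_ι_mul_ι_mul_ι _ _ _ _ _
  have h3 (σ : Equiv.Perm (Fin 4)) :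
      minor (P (σ 0)) (P (σ 1)) A * minor (P (σ 2)) (P (σ 3)) B = ∑ i, ∑ j, ∑ k, ∑ l,
        A.1 i j * B.1 k l * (P (σ 0) i * P (σ 1) j * P (σ 2) k * P (σ 3) l) := by
    simp only [minor_apply, Finset.sum_mul]
    simp only [Finset.mul_sum]
    refine Finset.sum_congr rfl fun i _ => Finset.sum_congr rfl fun j _ =>
      Finset.sum_congr rfl fun k _ => Finset.sum_congr rfl fun l _ => ?_
    ring
  have h4 : cliffordSymbol (wedge P) (spin A.1 * spin B.1) = ∑ i, ∑ j, ∑ k, ∑ l,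
      1 / 16 * (A.1 i j * B.1 k l *
        wedge P ![Pi.single i 1, Pi.single j 1, Pi.single k 1, Pi.single l 1]) := by
    simp only [spin, Finset.sum_mul]
    simp only [Finset.mul_sum, smul_mul_assoc, mul_smul_comm, map_sum,
      map_smul, h2, smul_eq_mul]
    refine Finset.sum_congr rfl fun i _ => Finset.sum_congr rfl fun j _ =>
      Finset.sum_congr rfl fun k _ => Finset.sum_congr rfl fun l _ => ?_
    ring
  rw [h4]
  simp only [h, h3, Finset.mul_sum]
  symm
  -- Each pass pulls one index sum out of the sum over permutations.
  iterate 4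
    rw [Finset.sum_comm]
    refine Finset.sum_congr rfl fun _ _ => ?_
  refine Finset.sum_congr rfl fun _ _ => ?_
  ring

/-- The commutator of the two spin elements is the spin element of the bracket, which has no part of
degree 4. -/
theorem cliffordSymbol_wedge_four_comm {n : ℕ} (P : Fin 4 → V n) (A B : so n) :
    cliffordSymbol (wedge P) (spin A.1 * spin B.1)
      = cliffordSymbol (wedge P) (spin B.1 * spin A.1) := by
  have h := cliffordSymbol_wedge_spin (by decide) (by decide) P ⁅A, B⁆
  rw [show (⁅A, B⁆ : so n).1 = A.1 * B.1 - B.1 * A.1 from rfl, spin_lie, map_sub] at h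
  exact sub_eq_zero.1 h

/-! ### Linear forms on the enveloping algebra -/

/-- The linear form on `U(so(n))` obtained from linear forms on the Weyl and the Clifford algebra
by way of the natural homomorphism. -/
def ueaForm {n : ℕ} (α : W n →ₗ[ℂ] ℂ) (β : C n →ₗ[ℂ] ℂ) :
    UniversalEnvelopingAlgebra ℂ (so n) →ₗ[ℂ] ℂ :=
  LinearMap.mul' ℂ ℂ ∘ₗ TensorProduct.map α β ∘ₗ (tama n).val.toLinearMap ∘ₗ
    (natHom n).toLinearMap

section ueaForm

variable {n : ℕ} (α : W n →ₗ[ℂ] ℂ) (β : C n →ₗ[ℂ] ℂ)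

theorem ueaForm_apply (u : UniversalEnvelopingAlgebra ℂ (so n)) :
    ueaForm α β u = LinearMap.mul' ℂ ℂ (TensorProduct.map α β (natHom n u : WC n)) := rfl

theorem ueaForm_of_mem_ker {u : UniversalEnvelopingAlgebra ℂ (so n)}
    (hu : u ∈ RingHom.ker (natHom n)) : ueaForm α β u = 0 := by
  rw [ueaForm_apply, (RingHom.mem_ker).1 hu]
  simp

theorem natHom_ι (A : so n) :
    (natHom n (UniversalEnvelopingAlgebra.ι ℂ A) : WC n)
      = orb A.1 ⊗ₜ[ℂ] (1 : C n) + (1 : W n) ⊗ₜ[ℂ] spin A.1 := by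
  rw [natHom, UniversalEnvelopingAlgebra.lift_ι_apply]
  exact soLin_eq A

theorem ueaForm_one : ueaForm α β 1 = α 1 * β 1 := by
  rw [ueaForm_apply, map_one (natHom n)]
  rfl

theorem ueaForm_ι (A : so n) : ueaForm α β (UniversalEnvelopingAlgebra.ι ℂ A)
    = α (orb A.1) * β 1 + α 1 * β (spin A.1) := by
  rw [ueaForm_apply, natHom_ι]
  simp

theorem ueaForm_ι_mul_ι (A B : so n) :
    ueaForm α β (UniversalEnvelopingAlgebra.ι ℂ A * UniversalEnvelopingAlgebra.ι ℂ B)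
      = α (orb A.1 * orb B.1) * β 1 + α (orb A.1) * β (spin B.1) + α (orb B.1) * β (spin A.1)
        + α 1 * β (spin A.1 * spin B.1) := by
  rw [ueaForm_apply, map_mul (natHom n), Subalgebra.coe_mul, natHom_ι, natHom_ι]
  simp only [mul_add, add_mul, Algebra.TensorProduct.tmul_mul_tmul, one_mul, mul_one, map_add,
    TensorProduct.map_tmul, LinearMap.mul'_apply]
  ring

/-- The two tensor factors commute, so the product expands over the choice of an orbital or spin
part for each letter, keeping the order inside each factor. The terms are grouped by the number of
spin letters. -/
theorem ueaForm_ι_mul_ι_mul_ι (A B D : so n) :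
    ueaForm α β (UniversalEnvelopingAlgebra.ι ℂ A * UniversalEnvelopingAlgebra.ι ℂ B *
        UniversalEnvelopingAlgebra.ι ℂ D)
      = α (orb A.1 * orb B.1 * orb D.1) * β 1
        + (α (orb A.1 * orb B.1) * β (spin D.1) + α (orb A.1 * orb D.1) * β (spin B.1)
          + α (orb B.1 * orb D.1) * β (spin A.1))
        + (α (orb A.1) * β (spin B.1 * spin D.1) + α (orb B.1) * β (spin A.1 * spin D.1)
          + α (orb D.1) * β (spin A.1 * spin B.1))
        + α 1 * β (spin A.1 * spin B.1 * spin D.1) := by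
  rw [ueaForm_apply, map_mul (natHom n), map_mul (natHom n), Subalgebra.coe_mul,
    Subalgebra.coe_mul, natHom_ι, natHom_ι, natHom_ι]
  simp only [mul_add, add_mul, Algebra.TensorProduct.tmul_mul_tmul, one_mul, mul_one, map_add,
    TensorProduct.map_tmul, LinearMap.mul'_apply]
  ring

end ueaForm

/-! ### The standard filtration -/

section filtration

variable {R 𝔤 : Type*} [CommRing R] [LieRing 𝔤] [LieAlgebra R 𝔤]

theorem prod_mem_ueaFiltration {p : ℕ} (l : List 𝔤) (hl : l.length ≤ p) :
    (l.map (UniversalEnvelopingAlgebra.ι R)).prod ∈ ueaFiltration R 𝔤 p :=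
  Submodule.subset_span ⟨l, hl, rfl⟩

theorem ueaFiltration_mono {p q : ℕ} (h : p ≤ q) : ueaFiltration R 𝔤 p ≤ ueaFiltration R 𝔤 q :=
  Submodule.span_mono fun _ ⟨l, hl, hu⟩ => ⟨l, hl.trans h, hu⟩

theorem ι_mem_ueaFiltration (A : 𝔤) :
    UniversalEnvelopingAlgebra.ι R A ∈ ueaFiltration R 𝔤 1 := by
  simpa using prod_mem_ueaFiltration (R := R) [A] le_rfl

theorem ι_mul_ι_mem_ueaFiltration (A B : 𝔤) :
    UniversalEnvelopingAlgebra.ι R A * UniversalEnvelopingAlgebra.ι R B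
      ∈ ueaFiltration R 𝔤 2 := by
  simpa using prod_mem_ueaFiltration (R := R) [A, B] le_rfl

theorem ι_mul_ι_comm (A B : 𝔤) :
    UniversalEnvelopingAlgebra.ι R A * UniversalEnvelopingAlgebra.ι R B
      = UniversalEnvelopingAlgebra.ι R B * UniversalEnvelopingAlgebra.ι R A
        + UniversalEnvelopingAlgebra.ι R ⁅A, B⁆ := by
  rw [LieHom.map_lie, LieRing.of_associative_ring_bracket]
  abel

theorem ueaFiltration_le {p : ℕ} (F : Submodule R (UniversalEnvelopingAlgebra R 𝔤))
    (h : ueaFiltration R 𝔤 p ≤ F) (h' : ∀ l : List 𝔤, l.length = p + 1 →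
      (l.map (UniversalEnvelopingAlgebra.ι R)).prod ∈ F) : ueaFiltration R 𝔤 (p + 1) ≤ F := by
  refine Submodule.span_le.2 ?_
  rintro _ ⟨l, hl, rfl⟩
  rcases Nat.le_succ_iff.1 hl with hl | hl
  · exact h (prod_mem_ueaFiltration l hl)
  · exact h' l hl

theorem exists_sub_ι_mem_ueaFiltration {u : UniversalEnvelopingAlgebra R 𝔤}
    (hu : u ∈ ueaFiltration R 𝔤 1) :
    ∃ A : 𝔤, u - UniversalEnvelopingAlgebra.ι R A ∈ ueaFiltration R 𝔤 0 := by
  have h : ueaFiltration R 𝔤 1 ≤ ueaFiltration R 𝔤 0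
      ⊔ LinearMap.range (UniversalEnvelopingAlgebra.ι R : 𝔤 →ₗ⁅R⁆ _).toLinearMap := by
    refine ueaFiltration_le _ le_sup_left fun l hl => ?_
    obtain ⟨A, rfl⟩ := List.length_eq_one_iff.1 hl
    exact Submodule.mem_sup_right ⟨A, by simp⟩
  obtain ⟨v, hv, _, ⟨A, rfl⟩, rfl⟩ := Submodule.mem_sup.1 (h hu)
  exact ⟨A, by simpa using hv⟩

variable {κ : Type*} [Fintype κ] (b : Module.Basis κ R 𝔤)

/-- The coefficients t are not unique; only their symmetrisation will matter. -/
theorem exists_sub_sum_two_mem_ueaFiltration {u : UniversalEnvelopingAlgebra R 𝔤}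
    (hu : u ∈ ueaFiltration R 𝔤 2) : ∃ t : κ → κ → R,
      u - ∑ i, ∑ j, t i j • (UniversalEnvelopingAlgebra.ι R (b i) *
        UniversalEnvelopingAlgebra.ι R (b j)) ∈ ueaFiltration R 𝔤 1 := by
  let Φ : (κ → κ → R) →ₗ[R] UniversalEnvelopingAlgebra R 𝔤 :=
    { toFun t := ∑ i, ∑ j, t i j • (UniversalEnvelopingAlgebra.ι R (b i) *
        UniversalEnvelopingAlgebra.ι R (b j))
      map_add' s t := by simp [add_smul, Finset.sum_add_distrib]
      map_smul' r t := by simp [mul_smul, Finset.smul_sum] }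
  have h : ueaFiltration R 𝔤 2 ≤ ueaFiltration R 𝔤 1 ⊔ LinearMap.range Φ := by
    refine ueaFiltration_le _ le_sup_left fun l hl => ?_
    obtain ⟨A, B, rfl⟩ := List.length_eq_two.1 hl
    refine Submodule.mem_sup_right ⟨fun i j => b.repr A i * b.repr B j, ?_⟩
    conv_rhs => rw [← b.sum_repr A, ← b.sum_repr B]
    simp only [Φ, LinearMap.coe_mk, AddHom.coe_mk, List.map_cons, List.map_nil, List.prod_cons,
      List.prod_nil, mul_one, map_sum, map_smul, Finset.sum_mul]
    simp only [Finset.mul_sum, smul_mul_smul_comm]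
  obtain ⟨v, hv, _, ⟨t, rfl⟩, rfl⟩ := Submodule.mem_sup.1 (h hu)
  exact ⟨t, by simpa [Φ] using hv⟩

theorem exists_sub_sum_three_mem_ueaFiltration {u : UniversalEnvelopingAlgebra R 𝔤}
    (hu : u ∈ ueaFiltration R 𝔤 3) : ∃ t : κ → κ → κ → R,
      u - ∑ i, ∑ j, ∑ k, t i j k • (UniversalEnvelopingAlgebra.ι R (b i) *
        UniversalEnvelopingAlgebra.ι R (b j) * UniversalEnvelopingAlgebra.ι R (b k))
          ∈ ueaFiltration R 𝔤 2 := by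
  let Φ : (κ → κ → κ → R) →ₗ[R] UniversalEnvelopingAlgebra R 𝔤 :=
    { toFun t := ∑ i, ∑ j, ∑ k, t i j k • (UniversalEnvelopingAlgebra.ι R (b i) *
        UniversalEnvelopingAlgebra.ι R (b j) * UniversalEnvelopingAlgebra.ι R (b k))
      map_add' s t := by simp [add_smul, Finset.sum_add_distrib]
      map_smul' r t := by simp [mul_smul, Finset.smul_sum] }
  have h : ueaFiltration R 𝔤 3 ≤ ueaFiltration R 𝔤 2 ⊔ LinearMap.range Φ := by
    refine ueaFiltration_le _ le_sup_left fun l hl => ?_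
    obtain ⟨A, B, D, rfl⟩ := List.length_eq_three.1 hl
    refine Submodule.mem_sup_right ⟨fun i j k => b.repr A i * b.repr B j * b.repr D k, ?_⟩
    conv_rhs => rw [← b.sum_repr A, ← b.sum_repr B, ← b.sum_repr D]
    simp only [Φ, LinearMap.coe_mk, AddHom.coe_mk, List.map_cons, List.map_nil, List.prod_cons,
      List.prod_nil, mul_one, map_sum, map_smul, Finset.sum_mul]
    simp only [Finset.mul_sum, smul_mul_smul_comm, mul_assoc]
  obtain ⟨v, hv, _, ⟨t, rfl⟩, rfl⟩ := Submodule.mem_sup.1 (h hu)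
  exact ⟨t, by simpa [Φ] using hv⟩

end filtration

theorem sum_symmetrize_smul {R M κ : Type*} [CommRing R] [AddCommGroup M] [Module R M] [Fintype κ]
    (t : κ → κ → κ → R) (g : κ → κ → κ → M) :
    ∑ i, ∑ j, ∑ k, t i j k • (g i j k + g i k j + g j i k + g j k i + g k i j + g k j i)
      = ∑ i, ∑ j, ∑ k, (t i j k + t i k j + t j i k + t j k i + t k i j + t k j i) • g i j k := by
  have h1 (f : κ → κ → κ → M) : ∑ i, ∑ j, ∑ k, f j i k = ∑ i, ∑ j, ∑ k, f i j k :=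
    Finset.sum_comm
  have h2 (f : κ → κ → κ → M) : ∑ i, ∑ j, ∑ k, f i k j = ∑ i, ∑ j, ∑ k, f i j k :=
    Finset.sum_congr rfl fun i _ => Finset.sum_comm
  have h3 (f : κ → κ → κ → M) : ∑ i, ∑ j, ∑ k, f j k i = ∑ i, ∑ j, ∑ k, f i j k :=
    (h1 fun i j k => f i k j).trans (h2 f)
  have h4 (f : κ → κ → κ → M) : ∑ i, ∑ j, ∑ k, f k i j = ∑ i, ∑ j, ∑ k, f i j k :=
    (h2 fun i j k => f j i k).trans (h1 f)
  have h5 (f : κ → κ → κ → M) : ∑ i, ∑ j, ∑ k, f k j i = ∑ i, ∑ j, ∑ k, f i j k :=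
    (h1 fun i j k => f k i j).trans (h4 f)
  simp only [smul_add, add_smul, Finset.sum_add_distrib]
  -- Moving a permutation from g to t inverts it: the transpositions correspond to themselves and
  -- the two 3-cycles trade places.
  rw [h2 fun i j k => t i k j • g i j k, h1 fun i j k => t j i k • g i j k,
    h3 fun i j k => t k i j • g i j k, h4 fun i j k => t j k i • g i j k,
    h5 fun i j k => t k j i • g i j k]
  abel

/-! ### Forms on the dual of `so(n)` -/

theorem minor_single {n : ℕ} (i j : Fin n) (A : so n) :
    minor (Pi.single i 1) (Pi.single j 1) A = A.1 i j := by
  simp [minor_apply, Pi.single_apply]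

/-- The factor 1/2 compensates for summing over ordered pairs: `X i j` and the minor both change
sign under i ↔ j, so each unordered pair counts twice. -/
theorem dual_so_eq_sum {n : ℕ} (f : Module.Dual ℂ (so n)) :
    f = ∑ i, ∑ j, (1 / 2 * f (X i j)) • minor (Pi.single i 1) (Pi.single j 1) := by
  ext A
  have hA : A = ∑ i, ∑ j, (1 / 2 * A.1 i j) • X i j := by
    ext k l
    have h : ((∑ i, ∑ j, (1 / 2 * A.1 i j) • X i j : so n) : Matrix (Fin n) (Fin n) ℂ) k l
        = ∑ i, ∑ j, 1 / 2 * A.1 i j * ((X i j : so n).1 k l) := by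
      simp [Matrix.sum_apply]
    rw [h]
    simp only [X, Matrix.sub_apply, Matrix.single_apply, mul_sub, Finset.sum_sub_distrib, ite_and,
      mul_ite, mul_one, mul_zero, Finset.sum_ite_irrel, Finset.sum_const_zero, Finset.sum_ite_eq',
      Finset.mem_univ, if_true]
    rw [skew_apply A k l]
    ring
  conv_lhs => rw [hA]
  simp only [map_sum, map_smul, LinearMap.sum_apply, LinearMap.smul_apply, minor_single,
    smul_eq_mul]
  refine Finset.sum_congr rfl fun i _ => Finset.sum_congr rfl fun j _ => ?_
  ring

theorem eq_zero_of_minor {n : ℕ} (φ : Module.Dual ℂ (so n) →ₗ[ℂ] ℂ)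
    (h : ∀ v w, φ (minor v w) = 0) : φ = 0 := by
  ext f
  rw [dual_so_eq_sum f]
  simp [h]

/-- A symmetric bilinear form on `so(n)*` which vanishes on the squares of decomposable elements
and whose totally skew-symmetric part vanishes is zero. -/
theorem bilin_dual_so_eq_zero {n : ℕ}
    (B : Module.Dual ℂ (so n) →ₗ[ℂ] Module.Dual ℂ (so n) →ₗ[ℂ] ℂ)
    (hsymm : ∀ f g, B f g = B g f) (hsq : ∀ v w, B (minor v w) (minor v w) = 0)
    (halt : ∀ P : Fin 4 → V n, ∑ σ : Equiv.Perm (Fin 4), (Equiv.Perm.sign σ : ℂ) *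
      B (minor (P (σ 0)) (P (σ 1))) (minor (P (σ 2)) (P (σ 3))) = 0) : B = 0 := by
  -- Polarise the vanishing squares in the second vector, then in the first, to get skewness under
  -- exchanging v and v'.
  have h1 (v w w' : V n) : B (minor v w) (minor v w') = 0 := by
    have h := hsq v (w + w')
    simp only [map_add, LinearMap.add_apply, hsq, zero_add, add_zero] at h
    rw [hsymm (minor v w')] at h
    exact self_eq_neg.1 (eq_neg_of_add_eq_zero_left h)
  have h2 (v v' w w' : V n) : B (minor v w) (minor v' w') = -B (minor v' w) (minor v w') := by
    have h := h1 (v + v') w w'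
    simp only [map_add, LinearMap.add_apply, h1, zero_add, add_zero] at h
    exact eq_neg_of_add_eq_zero_right h
  have h3 (v v' w w' : V n) : B (minor v w) (minor v' w') = -B (minor w v) (minor v' w') := by
    rw [minor_swap v w, map_neg, LinearMap.neg_apply]
  have h4 (v v' w w' : V n) : B (minor v w) (minor v' w') = -B (minor v w) (minor w' v') := by
    rw [minor_swap v' w', map_neg]
  have hswap (P : Fin 4 → V n) (i j : Fin 4) (hij : i ≠ j) :
      B (minor (P (Equiv.swap i j 0)) (P (Equiv.swap i j 1)))
        (minor (P (Equiv.swap i j 2)) (P (Equiv.swap i j 3)))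
      = -B (minor (P 0) (P 1)) (minor (P 2) (P 3)) := by
    -- The remaining transpositions (0 3), (1 2), (1 3) are conjugates of the exchanges (0 1), (2
    -- 3), (0 2) already known to change the sign.
    have a1 (v v' w w' : V n) : B (minor v w) (minor v' w') = -B (minor w' w) (minor v' v) := by
      rw [h4, h2, h4, neg_neg]
    have a2 (v v' w w' : V n) : B (minor v w) (minor v' w') = -B (minor v v') (minor w w') := by
      rw [h3, h2, h3, neg_neg]
    have a3 (v v' w w' : V n) : B (minor v w) (minor v' w') = -B (minor v w') (minor v' w) := by
      rw [h3, a1, h3, neg_neg]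
    fin_cases i <;> fin_cases j <;> first
      | exact absurd rfl hij
      | exact h2 _ _ _ _
      | exact h3 _ _ _ _
      | exact h4 _ _ _ _
      | exact a1 _ _ _ _
      | exact a2 _ _ _ _
      | exact a3 _ _ _ _
  have hperm (P : Fin 4 → V n) (σ : Equiv.Perm (Fin 4)) :
      B (minor (P (σ 0)) (P (σ 1))) (minor (P (σ 2)) (P (σ 3)))
        = (Equiv.Perm.sign σ : ℂ) * B (minor (P 0) (P 1)) (minor (P 2) (P 3)) := by
    induction σ using Equiv.Perm.swap_induction_on' with
    | one => simp
    | mul_swap σ i j hij ih =>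
      have := hswap (P ∘ σ) i j hij
      simp only [Function.comp_apply] at this
      simp only [Equiv.Perm.mul_apply, this, ih, Equiv.Perm.sign_mul, Equiv.Perm.sign_swap hij]
      simp
  have h0 (v w v' w' : V n) : B (minor v w) (minor v' w') = 0 := by
    have h := halt ![v, w, v', w']
    simp only [hperm, ← mul_assoc] at h
    -- B is already alternating in the four vectors, so its alternation is 4! times itself.
    rw [Finset.sum_congr rfl (g := fun _ => B (minor v w) (minor v' w'))] at h
    · simpa [Fintype.card_perm, Nat.factorial_ne_zero] using h
    · intro σ _
      rcases Int.units_eq_one_or (Equiv.Perm.sign σ) with h | h <;> simp [h]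
  ext f g
  have hf : B.flip g = 0 := eq_zero_of_minor _ fun v w => by
    exact LinearMap.congr_fun (eq_zero_of_minor (B (minor v w)) fun v' w' => h0 v w v' w') g
  exact LinearMap.congr_fun hf f

/-- The symmetric trilinear form on the dual space defined by the symmetrisation of a tensor,
as a bilinear form in the first two arguments. -/
def symTrilin {R M κ : Type*} [CommRing R] [AddCommGroup M] [Module R M] [Fintype κ]
    (b : κ → M) (t : κ → κ → κ → R) (h : Module.Dual R M) :
    Module.Dual R M →ₗ[R] Module.Dual R M →ₗ[R] R :=
  LinearMap.mk₂ R (fun f g => ∑ i, ∑ j, ∑ k, t i j k •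
      (f (b i) * g (b j) * h (b k) + f (b i) * g (b k) * h (b j) + f (b j) * g (b i) * h (b k)
        + f (b j) * g (b k) * h (b i) + f (b k) * g (b i) * h (b j) + f (b k) * g (b j) * h (b i)))
    (fun f f' g => by
      simp only [← Finset.sum_add_distrib, LinearMap.add_apply, smul_eq_mul]
      refine Finset.sum_congr rfl fun i _ => Finset.sum_congr rfl fun j _ =>
        Finset.sum_congr rfl fun k _ => ?_
      ring)
    (fun r f g => by
      simp only [Finset.mul_sum, LinearMap.smul_apply, smul_eq_mul]
      refine Finset.sum_congr rfl fun i _ => Finset.sum_congr rfl fun j _ =>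
        Finset.sum_congr rfl fun k _ => ?_
      ring)
    (fun f g g' => by
      simp only [← Finset.sum_add_distrib, LinearMap.add_apply, smul_eq_mul]
      refine Finset.sum_congr rfl fun i _ => Finset.sum_congr rfl fun j _ =>
        Finset.sum_congr rfl fun k _ => ?_
      ring)
    (fun r f g => by
      simp only [Finset.mul_sum, LinearMap.smul_apply, smul_eq_mul]
      refine Finset.sum_congr rfl fun i _ => Finset.sum_congr rfl fun j _ =>
        Finset.sum_congr rfl fun k _ => ?_
      ring)

section symTrilin

variable {R M κ : Type*} [CommRing R] [AddCommGroup M] [Module R M] [Fintype κ]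

theorem symTrilin_apply (b : κ → M) (t : κ → κ → κ → R) (f g h : Module.Dual R M) :
    symTrilin b t h f g = ∑ i, ∑ j, ∑ k, t i j k •
      (f (b i) * g (b j) * h (b k) + f (b i) * g (b k) * h (b j) + f (b j) * g (b i) * h (b k)
        + f (b j) * g (b k) * h (b i) + f (b k) * g (b i) * h (b j)
        + f (b k) * g (b j) * h (b i)) := rfl

theorem symTrilin_comm (b : κ → M) (t : κ → κ → κ → R) (f g h : Module.Dual R M) :
    symTrilin b t h f g = symTrilin b t h g f := by
  simp only [symTrilin_apply]
  refine Finset.sum_congr rfl fun i _ => Finset.sum_congr rfl fun j _ =>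
    Finset.sum_congr rfl fun k _ => ?_
  ring_nf

theorem symTrilin_right_comm (b : κ → M) (t : κ → κ → κ → R) (f g h : Module.Dual R M) :
    symTrilin b t h f g = symTrilin b t g f h := by
  simp only [symTrilin_apply]
  refine Finset.sum_congr rfl fun i _ => Finset.sum_congr rfl fun j _ =>
    Finset.sum_congr rfl fun k _ => ?_
  ring_nf

/-- Evaluating on dual basis vectors recovers the symmetrised coefficients of t. -/
theorem symTrilin_coord (b : Module.Basis κ R M) (t : κ → κ → κ → R) (i j k : κ) :
    symTrilin b t (b.coord k) (b.coord i) (b.coord j)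
      = t i j k + t i k j + t j i k + t j k i + t k i j + t k j i := by
  classical
  rw [symTrilin_apply, sum_symmetrize_smul t fun i' j' k' =>
    b.coord i (b i') * b.coord j (b j') * b.coord k (b k')]
  simp [Finsupp.single_apply]

end symTrilin

theorem symTrilin_dual_so_eq_zero {n : ℕ} {κ : Type*} [Fintype κ] (b : κ → so n)
    (t : κ → κ → κ → ℂ)
    (hsq : ∀ v w p q, symTrilin b t (minor p q) (minor v w) (minor v w) = 0)
    (halt : ∀ p q, ∀ P : Fin 4 → V n, ∑ σ : Equiv.Perm (Fin 4), (Equiv.Perm.sign σ : ℂ) *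
      symTrilin b t (minor p q) (minor (P (σ 0)) (P (σ 1))) (minor (P (σ 2)) (P (σ 3))) = 0)
    (f g h : Module.Dual ℂ (so n)) : symTrilin b t h f g = 0 := by
  have h1 (p q : V n) : symTrilin b t (minor p q) = 0 :=
    bilin_dual_so_eq_zero _ (fun f g => symTrilin_comm b t f g _) (fun v w => hsq v w p q)
      (halt p q)
  refine LinearMap.congr_fun (eq_zero_of_minor (symTrilin b t h f) fun p q => ?_) g
  rw [symTrilin_right_comm, h1]
  rfl

/-! ### Injectivity in low degrees -/

theorem ueaForm_eq_zero_of_mem {n p : ℕ} {α : W n →ₗ[ℂ] ℂ} {β : C n →ₗ[ℂ] ℂ}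
    (h : ∀ l : List (so n), l.length ≤ p →
      ueaForm α β (l.map (UniversalEnvelopingAlgebra.ι ℂ)).prod = 0)
    {u : UniversalEnvelopingAlgebra ℂ (so n)} (hu : u ∈ ueaFiltration ℂ (so n) p) :
    ueaForm α β u = 0 := by
  have : ueaFiltration ℂ (so n) p ≤ LinearMap.ker (ueaForm α β) :=
    Submodule.span_le.2 (by rintro _ ⟨l, hl, rfl⟩; exact h l hl)
  exact this hu

theorem ueaForm_eq_zero_of_mem_zero {n : ℕ} {α : W n →ₗ[ℂ] ℂ} {β : C n →ₗ[ℂ] ℂ}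
    (h0 : ueaForm α β 1 = 0)
    {u : UniversalEnvelopingAlgebra ℂ (so n)} (hu : u ∈ ueaFiltration ℂ (so n) 0) :
    ueaForm α β u = 0 := by
  refine ueaForm_eq_zero_of_mem (fun l hl => ?_) hu
  rw [List.length_eq_zero_iff.1 (Nat.le_zero.1 hl)]
  simpa using h0

theorem ueaForm_eq_zero_of_mem_one {n : ℕ} {α : W n →ₗ[ℂ] ℂ} {β : C n →ₗ[ℂ] ℂ}
    (h0 : ueaForm α β 1 = 0) (h1 : ∀ A, ueaForm α β (UniversalEnvelopingAlgebra.ι ℂ A) = 0)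
    {u : UniversalEnvelopingAlgebra ℂ (so n)} (hu : u ∈ ueaFiltration ℂ (so n) 1) :
    ueaForm α β u = 0 := by
  obtain ⟨A, hA⟩ := exists_sub_ι_mem_ueaFiltration hu
  have h := ueaForm_eq_zero_of_mem_zero h0 hA
  rwa [map_sub, h1, sub_zero] at h

/-- Applied to the remainder of a kernel element after its cubic part is subtracted, this turns a
suitable form into an equation on the cubic coefficients alone. -/
theorem ueaForm_eq_zero_of_mem_two {n : ℕ} {α : W n →ₗ[ℂ] ℂ} {β : C n →ₗ[ℂ] ℂ}
    (h0 : ueaForm α β 1 = 0) (h1 : ∀ A, ueaForm α β (UniversalEnvelopingAlgebra.ι ℂ A) = 0)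
    (h2 : ∀ A B, ueaForm α β
      (UniversalEnvelopingAlgebra.ι ℂ A * UniversalEnvelopingAlgebra.ι ℂ B) = 0)
    {u : UniversalEnvelopingAlgebra ℂ (so n)} (hu : u ∈ ueaFiltration ℂ (so n) 2) :
    ueaForm α β u = 0 := by
  obtain ⟨t, ht⟩ := exists_sub_sum_two_mem_ueaFiltration (Module.finBasis ℂ (so n)) hu
  have h := ueaForm_eq_zero_of_mem_one h0 h1 ht
  simpa only [map_sub, map_sum, map_smul, h2, smul_zero, Finset.sum_const_zero, sub_zero] using h

/-! ### Descent of kernel elements through the filtration -/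

theorem eq_zero_of_mem_ker_of_mem_zero {n : ℕ} {u : UniversalEnvelopingAlgebra ℂ (so n)}
    (hker : u ∈ RingHom.ker (natHom n)) (hu : u ∈ ueaFiltration ℂ (so n) 0) : u = 0 := by
  have h : ueaFiltration ℂ (so n) 0 ≤ Submodule.span ℂ {1} := by
    refine Submodule.span_le.2 ?_
    rintro _ ⟨l, hl, rfl⟩
    rw [List.length_eq_zero_iff.1 (Nat.le_zero.1 hl)]
    simp
  obtain ⟨c, rfl⟩ := Submodule.mem_span_singleton.1 (h hu)
  -- The projection to exterior degree 0, which shows that 1 is not sent to zero.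
  obtain ⟨β, hβ⟩ : ∃ β : C n →ₗ[ℂ] ℂ, β 1 = 1 :=
    ⟨(AlternatingMap.constOfIsEmpty ℂ (V n) (Fin 0) (1 : ℂ) |> cliffordSymbol), by
      rw [cliffordSymbol_apply, CliffordAlgebra.changeForm_one,
        ExteriorAlgebra.liftAlternating_one, Pi.single_eq_same]
      rfl⟩
  have h := ueaForm_of_mem_ker (weylSymbol 0 0 0) β hker
  rw [map_smul, ueaForm_one, weylSymbol_one, hβ] at h
  simp only [if_true, mul_one, smul_eq_mul] at h
  rw [h, zero_smul]

/-- In x-degree 0 and Clifford degree 2 only the spin part survives, and it reads off half of each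
matrix entry. -/
theorem mem_zero_of_mem_ker_of_mem_one {n : ℕ} {u : UniversalEnvelopingAlgebra ℂ (so n)}
    (hker : u ∈ RingHom.ker (natHom n)) (hu : u ∈ ueaFiltration ℂ (so n) 1) :
    u ∈ ueaFiltration ℂ (so n) 0 := by
  obtain ⟨A, hA⟩ := exists_sub_ι_mem_ueaFiltration hu
  have hA0 : A = 0 := by
    ext i j
    set β := cliffordSymbol (wedge ![Pi.single i 1, Pi.single j 1] : V n [⋀^Fin 2]→ₗ[ℂ] ℂ)
    have hβ : β 1 = 0 := cliffordSymbol_one two_ne_zero _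
    have h := ueaForm_eq_zero_of_mem_zero (α := weylSymbol 0 0 0) (β := β)
      (by rw [ueaForm_one, hβ, mul_zero]) hA
    rw [map_sub, ueaForm_of_mem_ker _ _ hker, ueaForm_ι, hβ, weylSymbol_one,
      cliffordSymbol_wedge_two_spin, minor_single] at h
    simpa using h
  simpa [hA0] using hA

/-- Pairing x-degree 1 with Clifford degree 2 selects one orbital and one spin letter, so the
symmetrised tensor S vanishes on pairs of decomposables. Hence t is skew, and the quadratic part is
half a sum of brackets. -/
theorem mem_one_of_mem_ker_of_mem_two {n : ℕ} {u : UniversalEnvelopingAlgebra ℂ (so n)}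
    (hker : u ∈ RingHom.ker (natHom n)) (hu : u ∈ ueaFiltration ℂ (so n) 2) :
    u ∈ ueaFiltration ℂ (so n) 1 := by
  set b := Module.finBasis ℂ (so n)
  obtain ⟨t, ht⟩ := exists_sub_sum_two_mem_ueaFiltration b hu
  let S : Module.Dual ℂ (so n) →ₗ[ℂ] Module.Dual ℂ (so n) →ₗ[ℂ] ℂ :=
    LinearMap.mk₂ ℂ (fun f g => ∑ i, ∑ j, t i j * (f (b i) * g (b j) + f (b j) * g (b i)))
      (fun f f' g => by
        simp only [← Finset.sum_add_distrib, LinearMap.add_apply]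
        refine Finset.sum_congr rfl fun i _ => Finset.sum_congr rfl fun j _ => ?_
        ring)
      (fun r f g => by
        simp only [Finset.mul_sum, LinearMap.smul_apply, smul_eq_mul]
        refine Finset.sum_congr rfl fun i _ => Finset.sum_congr rfl fun j _ => ?_
        ring)
      (fun f g g' => by
        simp only [← Finset.sum_add_distrib, LinearMap.add_apply]
        refine Finset.sum_congr rfl fun i _ => Finset.sum_congr rfl fun j _ => ?_
        ring)
      (fun r f g => by
        simp only [Finset.mul_sum, LinearMap.smul_apply, smul_eq_mul]
        refine Finset.sum_congr rfl fun i _ => Finset.sum_congr rfl fun j _ => ?_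
        ring)
  have hS (f g) : S f g = ∑ i, ∑ j, t i j * (f (b i) * g (b j) + f (b j) * g (b i)) := rfl
  have hminor (ξ μ p q : V n) : S (minor ξ μ) (minor p q) = 0 := by
    set β := cliffordSymbol (wedge ![p, q])
    have hβ : β 1 = 0 := cliffordSymbol_one two_ne_zero _
    have hα : weylSymbol 1 ξ μ 1 = 0 := weylSymbol_one 1 ξ μ
    have h := ueaForm_eq_zero_of_mem_one (α := weylSymbol 1 ξ μ) (β := β)
      (by rw [ueaForm_one, hβ, mul_zero]) (by intro A; rw [ueaForm_ι, hβ, hα]; ring) ht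
    simp only [map_sub, ueaForm_of_mem_ker _ _ hker, map_sum, map_smul, ueaForm_ι_mul_ι, hβ, hα,
      weylSymbol_orb, if_true, mul_zero, zero_mul, add_zero, zero_add, zero_sub, neg_eq_zero] at h
    -- The 2 clears the 1/2 in the value of a 2-form on `spin`.
    rw [hS, ← mul_eq_zero_of_right 2 h]
    simp only [β, cliffordSymbol_wedge_two_spin, Finset.mul_sum, smul_eq_mul]
    refine Finset.sum_congr rfl fun i _ => Finset.sum_congr rfl fun j _ => ?_
    ring
  have hS0 (f g) : S f g = 0 := by
    have hf : S.flip g = 0 := eq_zero_of_minor _ fun v w =>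
      LinearMap.congr_fun (eq_zero_of_minor (S (minor v w)) fun p q => hminor v w p q) g
    exact LinearMap.congr_fun hf f
  have hskew (i j) : t j i = - t i j := by
    have h := hS0 (b.coord i) (b.coord j)
    rw [hS] at h
    simp [Finsupp.single_apply, mul_add, Finset.sum_add_distrib] at h
    exact eq_neg_of_add_eq_zero_right h
  have hsum : (2 : ℂ) • ∑ i, ∑ j, t i j • (UniversalEnvelopingAlgebra.ι ℂ (b i) *
      UniversalEnvelopingAlgebra.ι ℂ (b j))
        = ∑ i, ∑ j, t i j • UniversalEnvelopingAlgebra.ι ℂ ⁅b i, b j⁆ := by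
    rw [two_smul]
    nth_rewrite 2 [Finset.sum_comm]
    simp only [← Finset.sum_add_distrib]
    refine Finset.sum_congr rfl fun i _ => Finset.sum_congr rfl fun j _ => ?_
    rw [hskew i j, ι_mul_ι_comm (b i) (b j), smul_add, neg_smul]
    abel
  have hmem : ∑ i, ∑ j, t i j • (UniversalEnvelopingAlgebra.ι ℂ (b i) *
      UniversalEnvelopingAlgebra.ι ℂ (b j)) ∈ ueaFiltration ℂ (so n) 1 := by
    rw [← Submodule.smul_mem_iff _ (two_ne_zero (α := ℂ)), hsum]
    exact Submodule.sum_mem _ fun i _ => Submodule.sum_mem _ fun j _ =>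
      Submodule.smul_mem _ _ (ι_mem_ueaFiltration _)
  simpa using Submodule.add_mem _ ht hmem

/-- Each reordering is reached by adjacent swaps, and each swap costs a word of length 2 containing
a bracket. The variables A, B, D keep the words atomic for the final `module`. -/
theorem ι_mul_ι_mul_ι_symmetrize_mem {R 𝔤 : Type*} [CommRing R] [LieRing 𝔤] [LieAlgebra R 𝔤]
    (a b d : 𝔤) {A B D : UniversalEnvelopingAlgebra R 𝔤}
    (hA : A = UniversalEnvelopingAlgebra.ι R a) (hB : B = UniversalEnvelopingAlgebra.ι R b)
    (hD : D = UniversalEnvelopingAlgebra.ι R d) :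
    (A * B * D + A * D * B + B * A * D + B * D * A + D * A * B + D * B * A)
      - (6 : R) • (A * B * D) ∈ ueaFiltration R 𝔤 2 := by
  have hl (x y z : 𝔤) : UniversalEnvelopingAlgebra.ι R x * UniversalEnvelopingAlgebra.ι R y *
      UniversalEnvelopingAlgebra.ι R z - UniversalEnvelopingAlgebra.ι R y *
        UniversalEnvelopingAlgebra.ι R x * UniversalEnvelopingAlgebra.ι R z
          ∈ ueaFiltration R 𝔤 2 := by
    rw [ι_mul_ι_comm x y, add_mul, add_sub_cancel_left]
    exact ι_mul_ι_mem_ueaFiltration _ _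
  have hr (x y z : 𝔤) : UniversalEnvelopingAlgebra.ι R x * UniversalEnvelopingAlgebra.ι R y *
      UniversalEnvelopingAlgebra.ι R z - UniversalEnvelopingAlgebra.ι R x *
        UniversalEnvelopingAlgebra.ι R z * UniversalEnvelopingAlgebra.ι R y
          ∈ ueaFiltration R 𝔤 2 := by
    rw [mul_assoc, ι_mul_ι_comm y z, mul_add, ← mul_assoc, add_sub_cancel_left]
    exact ι_mul_ι_mem_ueaFiltration _ _
  have h1 := hr a d b
  have h2 := hl b a d
  have h3 := add_mem (hr b d a) h2
  have h4 := add_mem (hl d a b) h1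
  have h5 := add_mem (hl d b a) h3
  rw [← hA, ← hB, ← hD] at h1 h2 h3 h4 h5
  convert add_mem (add_mem (add_mem (add_mem h1 h2) h3) h4) h5 using 1
  module

/-- Two pairings are used: x-degree 2 with Clifford degree 2 for `hsq`, and x-degree 1 with Clifford
degree 4 for `halt`. In both, words of length at most 2 have too few letters to contribute. -/
theorem mem_two_of_mem_ker_of_mem_three {n : ℕ} {u : UniversalEnvelopingAlgebra ℂ (so n)}
    (hker : u ∈ RingHom.ker (natHom n)) (hu : u ∈ ueaFiltration ℂ (so n) 3) :
    u ∈ ueaFiltration ℂ (so n) 2 := by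
  set b := Module.finBasis ℂ (so n)
  obtain ⟨t, ht⟩ := exists_sub_sum_three_mem_ueaFiltration b hu
  have hsq (v w p q : V n) : symTrilin b t (minor p q) (minor v w) (minor v w) = 0 := by
    set β := cliffordSymbol (wedge ![p, q])
    have hβ : β 1 = 0 := cliffordSymbol_one two_ne_zero _
    have hα : weylSymbol 2 v w 1 = 0 := weylSymbol_one 2 v w
    have hα1 (A : so n) : weylSymbol 2 v w (orb A.1) = 0 := weylSymbol_orb 2 v w A
    have h := ueaForm_eq_zero_of_mem_two (α := weylSymbol 2 v w) (β := β)
      (by rw [ueaForm_one, hβ, mul_zero]) (by intro A; rw [ueaForm_ι, hβ, hα]; ring)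
      (by intro A B; rw [ueaForm_ι_mul_ι, hβ, hα, hα1, hα1]; ring) ht
    simp only [map_sub, ueaForm_of_mem_ker _ _ hker, map_sum, map_smul, ueaForm_ι_mul_ι_mul_ι, hβ,
      hα, hα1, mul_zero, zero_mul, add_zero, zero_add, zero_sub, neg_eq_zero] at h
    -- One 2 clears the 1/2 from `spin`; the other appears because the six symmetrised terms
    -- coincide in pairs when two arguments are equal.
    rw [symTrilin_apply, ← mul_eq_zero_of_right 4 h]
    simp only [β, cliffordSymbol_wedge_two_spin, weylSymbol_two_orb_mul_orb, Finset.mul_sum,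
      smul_eq_mul]
    refine Finset.sum_congr rfl fun i _ => Finset.sum_congr rfl fun j _ =>
      Finset.sum_congr rfl fun k _ => ?_
    ring
  have halt (p q : V n) (P : Fin 4 → V n) :
      ∑ σ : Equiv.Perm (Fin 4), (Equiv.Perm.sign σ : ℂ) * symTrilin b t (minor p q)
        (minor (P (σ 0)) (P (σ 1))) (minor (P (σ 2)) (P (σ 3))) = 0 := by
    set β := cliffordSymbol (wedge P) with hβdef
    have hβ : β 1 = 0 := cliffordSymbol_one (by decide) _
    have hβ1 (A : so n) : β (spin A.1) = 0 := cliffordSymbol_wedge_spin (by decide) (by decide) P A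
    have hα : weylSymbol 1 p q 1 = 0 := weylSymbol_one 1 p q
    have h := ueaForm_eq_zero_of_mem_two (α := weylSymbol 1 p q) (β := β)
      (by rw [ueaForm_one, hβ, mul_zero]) (by intro A; rw [ueaForm_ι, hβ, hα]; ring)
      (by intro A B; rw [ueaForm_ι_mul_ι, hβ, hα, hβ1, hβ1]; ring) ht
    simp only [map_sub, ueaForm_of_mem_ker _ _ hker, map_sum, map_smul, ueaForm_ι_mul_ι_mul_ι, hβ,
      hα, hβ1, weylSymbol_orb, if_true, mul_zero, zero_mul, add_zero, zero_add, zero_sub,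
      neg_eq_zero] at h
    have hβ2 (A B : so n) : ∑ σ : Equiv.Perm (Fin 4), (Equiv.Perm.sign σ : ℂ) *
        (minor (P (σ 0)) (P (σ 1)) A * minor (P (σ 2)) (P (σ 3)) B)
          = 16 * β (spin A.1 * spin B.1) := by
      rw [hβdef, cliffordSymbol_wedge_four_spin_mul_spin]
      ring
    have hβ3 (A B : so n) : β (spin A.1 * spin B.1) = β (spin B.1 * spin A.1) :=
      cliffordSymbol_wedge_four_comm P A B
    -- 32 = 2 · 16: the 16 clears the 1/16 from two spin factors, and the 2 counts the two orders of
    -- the spin letters, equal by `hβ3`.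
    rw [← mul_eq_zero_of_right 32 h]
    simp only [symTrilin_apply, Finset.mul_sum]
    -- With the permutation sum innermost, the identity can be checked for each coefficient t i j k
    -- separately.
    iterate 3
      rw [Finset.sum_comm]
      refine Finset.sum_congr rfl fun _ _ => ?_
    rename_i i _ j _ k _
    have hsum : ∀ A B D : so n, ∀ c : ℂ, c * (minor p q D * (16 * β (spin A.1 * spin B.1)
        + 16 * β (spin B.1 * spin A.1))) = ∑ σ : Equiv.Perm (Fin 4), (Equiv.Perm.sign σ : ℂ) *
          (c * (minor (P (σ 0)) (P (σ 1)) A * minor (P (σ 2)) (P (σ 3)) B * minor p q D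
            + minor (P (σ 0)) (P (σ 1)) B * minor (P (σ 2)) (P (σ 3)) A * minor p q D)) := by
      intro A B D c
      rw [← hβ2, ← hβ2, ← Finset.sum_add_distrib, Finset.mul_sum, Finset.mul_sum]
      refine Finset.sum_congr rfl fun σ _ => ?_
      ring
    have h1 := hsum (b i) (b j) (b k) (t i j k)
    have h2 := hsum (b i) (b k) (b j) (t i j k)
    have h3 := hsum (b j) (b k) (b i) (t i j k)
    trans t i j k * (minor p q (b k) * (32 * β (spin (b i).1 * spin (b j).1)))
      + t i j k * (minor p q (b j) * (32 * β (spin (b i).1 * spin (b k).1)))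
      + t i j k * (minor p q (b i) * (32 * β (spin (b j).1 * spin (b k).1)))
    · rw [hβ3 (b j) (b i), ← two_mul, ← mul_assoc (2 : ℂ)] at h1
      rw [hβ3 (b k) (b i), ← two_mul, ← mul_assoc (2 : ℂ)] at h2
      rw [hβ3 (b k) (b j), ← two_mul, ← mul_assoc (2 : ℂ)] at h3
      norm_num only at h1 h2 h3
      rw [h1, h2, h3, ← Finset.sum_add_distrib, ← Finset.sum_add_distrib]
      refine Finset.sum_congr rfl fun σ _ => ?_
      rw [smul_eq_mul]
      ring
    · rw [smul_eq_mul]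
      ring
  have hs (i j k) : t i j k + t i k j + t j i k + t j k i + t k i j + t k j i = 0 := by
    rw [← symTrilin_coord b t]
    exact symTrilin_dual_so_eq_zero b t hsq halt _ _ _
  have hsum := sum_symmetrize_smul t fun i j k => UniversalEnvelopingAlgebra.ι ℂ (b i) *
    UniversalEnvelopingAlgebra.ι ℂ (b j) * UniversalEnvelopingAlgebra.ι ℂ (b k)
  simp only [hs, zero_smul, Finset.sum_const_zero] at hsum
  have hmem : ∑ i, ∑ j, ∑ k, t i j k • (UniversalEnvelopingAlgebra.ι ℂ (b i) *
      UniversalEnvelopingAlgebra.ι ℂ (b j) * UniversalEnvelopingAlgebra.ι ℂ (b k))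
        ∈ ueaFiltration ℂ (so n) 2 := by
    -- The symmetrised sum is zero, so minus six times the cubic part equals a combination of the
    -- differences just controlled; 6 is invertible.
    rw [← Submodule.smul_mem_iff _ (OfNat.ofNat_ne_zero (R := ℂ) 6), ← Submodule.neg_mem_iff,
      ← zero_sub, ← hsum]
    simp only [Finset.smul_sum, ← Finset.sum_sub_distrib, smul_comm (6 : ℂ), ← smul_sub]
    exact Submodule.sum_mem _ fun i _ => Submodule.sum_mem _ fun j _ =>
      Submodule.sum_mem _ fun k _ => Submodule.smul_mem _ _
        (ι_mul_ι_mul_ι_symmetrize_mem _ _ _ rfl rfl rfl)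
  simpa using Submodule.add_mem _ ht hmem

end TAMA

end

theorem mainTheorem5 (n p : ℕ) (hp : p ≤ 3)
    (u : UniversalEnvelopingAlgebra ℂ (TAMA.so n))
    (hker : u ∈ RingHom.ker (TAMA.natHom n))
    (hu : u ∈ TAMA.ueaFiltration ℂ (TAMA.so n) p) :
    u = 0 := by
  have h3 := TAMA.ueaFiltration_mono hp hu
  have h2 := TAMA.mem_two_of_mem_ker_of_mem_three hker h3
  have h1 := TAMA.mem_one_of_mem_ker_of_mem_two hker h2
  exact TAMA.eq_zero_of_mem_ker_of_mem_zero hker (TAMA.mem_zero_of_mem_ker_of_mem_one hker h1)
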